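/- **Setting.** Let $n$ be the number of variables and $\Delta(t)=\prod_{1\le i<j\le n}(t_i-t_j)$. Let $T\subseteq\mathbb C$ be a domain, $p$ holomorphic on $T$, $q$ holomorphic on $T^n$, and $h$ an entire function with $h(cx)=c^{\nu}h(x)$ for all $x\in\mathbb{C}$ and $\operatorname{Re}c>0$, where $\nu\ge 0$. Let $\mathscr P$ be a continuous, piecewise $C^1$ path in $T$ from $a$ to $b$, where $a,b$ are the (finite or infinite) endpoints, which need not lie in $T$, and for $N>0$ put $$I_N=\int_{\mathscr P}\cdots\int_{\mathscr P}\exp\Big\{-N\sum_{j=1}^n p(t_j)\Big\}\,h(\Delta(t))\,q(t)\,dt_1\cdots dt_n .$$ Let $x_0$ be an interior point of $\mathscr P$, and let $\mu\ge 2$ be an integer. Write $t^{\lambda-1}=\prod_j t_j^{\lambda_j-1}$, $|\lambda|=\sum_j\lambda_j$, $n_\nu=\nu n(n-1)/2$, $t_0=(x_0,\dots,x_0)$, $p_0=p^{(\mu)}(x_0)/\mu!$. Assume: 1. $p'(x_0)=\cdots=p^{(\mu-1)}(x_0)=0$ and $p^{(\mu)}(x_0)\ne 0$; and near $t_0$ (off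 the hyperplanes $t_j=x_0$) $q(t)=(t-t_0)^{\lambda-1}g(t-t_0)$ with real $\lambda_j>0$ and $g$ given by a power series convergent near $0$. 2. For some $N_0>0$ the integral $I_{N_0}$ converges absolutely. 3. $\operatorname{Re}\{p(x)-p(x_0)\}>0$ along $\mathscr P$ except when the path is at $x_0$ (through which it passes once), and this quantity is bounded away from $0$ as $x\to a$ or $x\to b$ along $\mathscr P$. Let $w(x)=(x-x_0)(1+O(x-x_0))$ be the holomorphic branch near $x_0$ of $\big((p(x)-p(x_0))/p_0\big)^{1/\mu}$. **Theorem 3.4.** The integral $I_N$ converges absolutely for all $N\ge N_0$. The map $w$ has a holomorphic local inverse $\varphi$ with $\varphi(0)=x_0$, and there are homogeneous polynomials $a_j(w)=\sum_{|k|=j}a_{j,k}w^k$ of degree $j$ such that, for small $w=(w_1,\dots,w_n)$ with all $w_i\neq0$, $$q(\varphi(w_1),\dots,\varphi(w_n))\Big(\prod_{i<j}\frac{\varphi(w_i)-\varphi(w_j)}{w_i-w_j}\Big)^{\nu}\prod_{j=1}^n\varphi'(w_j)=w^{\lambda-1}\sum_{j=0}^\infty a_j(w)$$ (the difference quotient is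 $\varphi'(w_i)$ if $w_i=w_j$). Moreover, let $\tau_1$ and $\tau_2$ be any points of $\mathscr P$ respectively before and after $x_0$ and sufficiently close to it along $\mathscr P$, let $L_1$ be the ray coming straight from infinity through $w(\tau_1)$ to $0$, and $L_2$ the ray going from $0$ through $w(\tau_2)$ straight to infinity. Then the integrals $$A_j=\int_{L_1\cup L_2}\cdots\int_{L_1\cup L_2}\exp\Big\{-p_0\sum_{i=1}^n w_i^{\mu}\Big\}\,h(\Delta(w))\,w^{\lambda-1}a_j(w)\,dw_1\cdots dw_n$$ converge absolutely, and for every $m\in\{0,1,2,\dots\}$, as $N\to\infty$ through the real numbers, $$I_N=e^{-nNp(x_0)}\Big\{\sum_{j=0}^{m-1}\frac{A_j}{N^{(n_\nu+|\lambda|+j)/\mu}}+O\Big(\frac1{N^{(n_\nu+|\lambda|+m)/\mu}}\Big)\Big\}.$$ -/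

import Mathlib

open Filter Topology Asymptotics MeasureTheory

/-- The Vandermonde product `Δ(t) = ∏_{i<j} (t_i - t_j)`. -/
noncomputable def vanderProd {n : ℕ} (t : Fin n → ℂ) : ℂ :=
  ∏ i, ∏ j ∈ Finset.Ioi i, (t i - t j)

/-- The multi-power `t^(lam - 1) = ∏_j t_j^(lam_j - 1)`. -/
noncomputable def powSubOne {n : ℕ} (lam : Fin n → ℝ) (t : Fin n → ℂ) : ℂ :=
  ∏ j, (t j) ^ ((lam j - 1 : ℝ) : ℂ)

/-- `γ` is continuous and piecewise `C¹`: away from a set `E` that has finitely many points in every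
compact interval, and up to the endpoints of every interval that avoids `E`, it is `C¹`. -/
def PiecewiseC1 (γ : ℝ → ℂ) : Prop :=
  Continuous γ ∧ ∃ E : Set ℝ, (∀ c d : ℝ, (E ∩ Set.Icc c d).Finite) ∧
    ∀ c d : ℝ, c < d → Disjoint E (Set.Ioo c d) → ContDiffOn ℝ 1 γ (Set.Icc c d)

/-- `γ : ℝ → ℂ` parametrizes an (open) integration path `(a, b)` in `T`; each of the endpoints `a`
and `b` is a complex number or the point at infinity. -/
structure IsContour (γ : ℝ → ℂ) (T : Set ℂ) (a b : OnePoint ℂ) : Prop where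
  piecewise : PiecewiseC1 γ
  mem : ∀ s, γ s ∈ T
  start : Tendsto (fun s => (γ s : OnePoint ℂ)) atBot (𝓝 a)
  finish : Tendsto (fun s => (γ s : OnePoint ℂ)) atTop (𝓝 b)

/-- The pull-back to `ℝⁿ`, along the path `γ` in every variable, of `G(t) dt_1 ⋯ dt_n`. -/
noncomputable def contourIntegrand {n : ℕ} (γ : ℝ → ℂ) (G : (Fin n → ℂ) → ℂ) (s : Fin n → ℝ) : ℂ :=
  G (fun j => γ (s j)) * ∏ j, deriv γ (s j)

/-- The `n`-fold contour integral `∫_γ ⋯ ∫_γ G(t) dt_1 ⋯ dt_n` converges absolutely. -/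
def ContourIntegrable {n : ℕ} (γ : ℝ → ℂ) (G : (Fin n → ℂ) → ℂ) : Prop :=
  Integrable (contourIntegrand γ G)

/-- The `n`-fold contour integral `∫_γ ⋯ ∫_γ G(t) dt_1 ⋯ dt_n`. -/
noncomputable def contourIntegral {n : ℕ} (γ : ℝ → ℂ) (G : (Fin n → ℂ) → ℂ) : ℂ :=
  ∫ s : Fin n → ℝ, contourIntegrand γ G s

/-- `exp(-N ∑_j p(t_j)) h(Δ(t)) q(t)`. -/
noncomputable def laplaceIntegrand {n : ℕ} (p h : ℂ → ℂ) (q : (Fin n → ℂ) → ℂ) (N : ℝ)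
    (t : Fin n → ℂ) : ℂ :=
  Complex.exp (-(N * ∑ j, p (t j))) * h (vanderProd t) * q t

/-- `p_0 = p^(μ)(x₀) / μ!`, the first coefficient of `p(x) - p(x₀) = ∑_s p_s (x - x₀)^(s+μ)`. -/
noncomputable def leadCoeff (p : ℂ → ℂ) (x₀ : ℂ) (μ : ℕ) : ℂ :=
  iteratedDeriv μ p x₀ / (μ.factorial : ℂ)

/-- The local coordinate `w(x)` at a saddle point `x₀` of order `μ - 1`: the branch near `x₀` of
`((p(x) - p(x₀)) / p_0)^(1/μ)` with `w(x) = (x - x₀)(1 + O(x - x₀))`. The base of the principal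
power tends to `1` as `x → x₀`, and the value at `x₀` is `0`. -/
noncomputable def saddleCoord (p : ℂ → ℂ) (x₀ : ℂ) (μ : ℕ) (x : ℂ) : ℂ :=
  (x - x₀) * ((p x - p x₀) / (leadCoeff p x₀ μ * (x - x₀) ^ μ)) ^ (1 / (μ : ℂ))

/-- For a change of variables `t_j = φ(w_j)`, the amplitude
`f(w) = q(t) (∏_{i<j} (t_i - t_j)/(w_i - w_j))^ν ∏_j φ'(w_j)`, with the difference quotient
read as `φ'(w_i)` where `w_i = w_j`. -/
noncomputable def amplitude {n : ℕ} (q : (Fin n → ℂ) → ℂ) (ν : ℝ) (φ : ℂ → ℂ)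
    (w : Fin n → ℂ) : ℂ :=
  q (fun j => φ (w j)) * (∏ i, ∏ j ∈ Finset.Ioi i, dslope φ (w i) (w j)) ^ (ν : ℂ) *
    ∏ j, deriv φ (w j)

/-- The path `L₁ ∪ L₂` made of two rays: `L₁` comes straight from infinity through `κ₁`
(at parameter `-1`) to `0`, and `L₂` goes from `0` through `κ₂` (at parameter `1`) to infinity. -/
noncomputable def rayPath (κ₁ κ₂ : ℂ) (r : ℝ) : ℂ :=
  if r < 0 then ((-r : ℝ) : ℂ) * κ₁ else (r : ℂ) * κ₂

/-- The integrand `exp(-p_0 ∑_j w_j^μ) h(Δ(w)) w^(lam-1) a(w)` of a coefficient. -/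
noncomputable def coeffIntegrand {n : ℕ} (p₀ : ℂ) (μ : ℕ) (h : ℂ → ℂ) (lam : Fin n → ℝ)
    (a : MvPolynomial (Fin n) ℂ) (w : Fin n → ℂ) : ℂ :=
  Complex.exp (-(p₀ * ∑ j, w j ^ μ)) * h (vanderProd w) * powSubOne lam w * MvPolynomial.eval w a

/-- The exponent `(n_ν + |lam| + j)/μ` with `n_ν = ν n (n-1)/2` and `|lam| = ∑_i lam_i`. -/
noncomputable def expansionExponent {n : ℕ} (ν : ℝ) (lam : Fin n → ℝ) (μ j : ℕ) : ℝ :=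
  (ν * n * ((n : ℝ) - 1) / 2 + ∑ i, lam i + j) / μ

/-! If one variable stays away from `x₀` on the path, the integrand is exponentially small relative
to `exp(-nNp(x₀))`, so only a short stretch of the path about `x₀` matters. There `t = φ(w)` turns
`p(t) - p(x₀)` into `p₀ w^μ` exactly and multiplies the Vandermonde product by the difference
quotients of `φ`. Their product is `1` at the origin, so it has positive real part nearby, and
homogeneity of `h` takes it out as a `ν`-th power. What is left is `exp(-N p₀ ∑ w_j^μ) h(Δ(w)) f(w)`
with `f` the amplitude.

Two facts about `f` are used. It is holomorphic at `0`, because `t₀` lies in `Tⁿ`; so Cauchy's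
theorem in a polydisk (`IsArcInDisk.integral_contourIntegrand_eq`) replaces the image arc in every
variable by the segments from `w(τ₁)` to `0` to `w(τ₂)`. And off the coordinate hyperplanes it
equals `w^(lam-1) F(w)` with `F` analytic (`amplitude_factor`): by division if all `lam_j` are
integers, and otherwise because single-valuedness forces `q` to vanish near `t₀`. The `a_j` are the
homogeneous terms of `F`.

Since `p₀ w(τ)^μ = p(τ) - p(x₀)` has positive real part, the exponential decays along both rays. The
dilation `w ↦ N^(-1/μ) w` preserves the rays and extracts the power of `N` from each homogeneous
term (`rayKernel_smul`). Cutting `F` off outside the segments and subtracting the terms of degree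
below `m` leaves `O(‖s‖^m)` on the whole parameter space (`exists_remainder_bound`), so the same
dilation gives the error term (`isBigO_ray_expansion`). -/

/-! ### The local coordinate at the saddle point -/

theorem exists_saddle_factor {p : ℂ → ℂ} {x₀ : ℂ} {μ : ℕ} (hμ : 1 ≤ μ) (hp : AnalyticAt ℂ p x₀)
    (hsaddle : ∀ k : ℕ, 1 ≤ k → k < μ → iteratedDeriv k p x₀ = 0) :
    ∃ P : ℂ → ℂ, AnalyticAt ℂ P x₀ ∧ P x₀ = leadCoeff p x₀ μ ∧
      ∀ x, p x - p x₀ = (x - x₀) ^ μ * P x := by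
  have hf : AnalyticAt ℂ (fun z => p (x₀ + z)) 0 :=
    AnalyticAt.fun_comp (by simpa using hp) (by fun_prop)
  -- Expanding to order `μ + 1` makes the term of degree `μ` explicit, so that `P x₀` can be read
  -- off.
  obtain ⟨F, hF, hFe⟩ := hf.exists_eq_sum_add_pow_mul (μ + 1)
  refine ⟨fun x => leadCoeff p x₀ μ + (x - x₀) * F (x - x₀), ?_, by simp, fun x => ?_⟩
  · have : AnalyticAt ℂ (fun x => F (x - x₀)) x₀ :=
      AnalyticAt.fun_comp (by simpa using hF) (by fun_prop)
    exact analyticAt_const.fun_add ((analyticAt_id.fun_sub analyticAt_const).fun_mul this)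
  · have h1 := hFe (x - x₀)
    obtain ⟨k, rfl⟩ : ∃ k, μ = k + 1 := ⟨μ - 1, by omega⟩
    simp only [iteratedDeriv_comp_const_add, add_zero] at h1
    rw [Finset.sum_range_succ, Finset.sum_range_succ', Finset.sum_eq_zero] at h1
    · simp only [add_sub_cancel, pow_zero, Nat.factorial_zero, iteratedDeriv_zero, smul_eq_mul] at h1
      rw [h1, leadCoeff]
      push_cast
      ring
    · intro i hi
      rw [hsaddle (i + 1) (by omega) (by simpa using hi), smul_zero]

/-- Valid for every `x`, not just near `x₀`: the `μ`-th power of any branch of a `μ`-th root returns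
the base. -/
theorem leadCoeff_mul_saddleCoord_pow {p : ℂ → ℂ} {x₀ : ℂ} {μ : ℕ} (hμ : 1 ≤ μ)
    (h0 : leadCoeff p x₀ μ ≠ 0) (x : ℂ) :
    leadCoeff p x₀ μ * saddleCoord p x₀ μ x ^ μ = p x - p x₀ := by
  have hμ' : μ ≠ 0 := by omega
  rcases eq_or_ne x x₀ with rfl | hx
  · simp [saddleCoord, hμ']
  · have : (x - x₀) ^ μ ≠ 0 := pow_ne_zero _ (sub_ne_zero.2 hx)
    rw [saddleCoord, mul_pow, one_div, Complex.cpow_nat_inv_pow _ hμ']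
    field_simp

/-- The base of the principal power extends analytically to `x₀` with value `1`, which is off the
branch cut. -/
theorem saddleCoord_analyticAt {p : ℂ → ℂ} {x₀ : ℂ} {μ : ℕ} (hμ : 1 ≤ μ) (hp : AnalyticAt ℂ p x₀)
    (hsaddle : ∀ k : ℕ, 1 ≤ k → k < μ → iteratedDeriv k p x₀ = 0)
    (h0 : leadCoeff p x₀ μ ≠ 0) :
    AnalyticAt ℂ (saddleCoord p x₀ μ) x₀ ∧ deriv (saddleCoord p x₀ μ) x₀ = 1 := by
  obtain ⟨P, hP, hP0, hPe⟩ := exists_saddle_factor hμ hp hsaddle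
  have he : saddleCoord p x₀ μ =
      fun x => (x - x₀) * (P x / leadCoeff p x₀ μ) ^ (1 / (μ : ℂ)) := by
    funext x
    rcases eq_or_ne x x₀ with rfl | hx
    · simp [saddleCoord]
    · have : (x - x₀) ^ μ ≠ 0 := pow_ne_zero _ (sub_ne_zero.2 hx)
      rw [saddleCoord, hPe]
      congr 2
      field_simp
  have hc : AnalyticAt ℂ (fun x => (P x / leadCoeff p x₀ μ) ^ (1 / (μ : ℂ))) x₀ := by
    refine AnalyticAt.cpow (hP.div analyticAt_const h0) analyticAt_const ?_
    simp [hP0, div_self h0]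
  rw [he]
  refine ⟨by fun_prop, ?_⟩
  have h1 : HasDerivAt (fun x : ℂ => x - x₀) 1 x₀ := (hasDerivAt_id x₀).sub_const x₀
  have := (h1.mul hc.differentiableAt.hasDerivAt).deriv
  simpa [hP0, div_self h0, Pi.mul_def] using this

theorem exists_analytic_local_inverse {f : ℂ → ℂ} {x : ℂ} (hf : AnalyticAt ℂ f x)
    (hf' : deriv f x ≠ 0) :
    ∃ φ : ℂ → ℂ, AnalyticAt ℂ φ (f x) ∧ φ (f x) = x ∧ (∀ᶠ v in 𝓝 (f x), f (φ v) = v) ∧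
      ∀ᶠ y in 𝓝 x, φ (f y) = y :=
  ⟨_, hf.analyticAt_localInverse hf', HasStrictFDerivAt.localInverse_apply_image ..,
    HasStrictDerivAt.eventually_right_inverse .., HasStrictDerivAt.eventually_left_inverse ..⟩

/-! ### Analyticity of the difference quotient and of the amplitude -/

/-- The power series at `(0, 0)` of the divided difference of the function with series `c`. -/
noncomputable def dividedDifferenceSeries (c : ℕ → ℂ) : FormalMultilinearSeries ℂ (ℂ × ℂ) ℂ :=
  fun k => c (k + 1) • ∑ j ∈ Finset.range (k + 1),
    (ContinuousMultilinearMap.mkPiAlgebra ℂ (Fin k) ℂ).compContinuousLinearMap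
      fun i : Fin k => if (i : ℕ) < j then ContinuousLinearMap.fst ℂ ℂ ℂ
        else ContinuousLinearMap.snd ℂ ℂ ℂ

theorem dividedDifferenceSeries_apply (c : ℕ → ℂ) (k : ℕ) (a b : ℂ) :
    dividedDifferenceSeries c k (fun _ => (a, b)) =
      c (k + 1) * ∑ j ∈ Finset.range (k + 1), a ^ j * b ^ (k - j) := by
  simp only [dividedDifferenceSeries, smul_apply,
    sum_apply, ContinuousMultilinearMap.compContinuousLinearMap_apply,
    ContinuousMultilinearMap.mkPiAlgebra_apply, smul_eq_mul]
  congr 1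
  refine Finset.sum_congr rfl fun j hj => ?_
  have hj' : j ≤ k := by simpa [Nat.lt_succ_iff] using hj
  have : ∀ i : Fin k, (if (i : ℕ) < j then ContinuousLinearMap.fst ℂ ℂ ℂ
        else ContinuousLinearMap.snd ℂ ℂ ℂ) (a, b) = if (i : ℕ) < j then a else b := by
    intro i; split_ifs <;> rfl
  simp only [this]
  rw [Fin.prod_univ_eq_prod_range (fun i => if i < j then a else b) k,
    ← Finset.prod_range_mul_prod_Ico _ hj']
  congr 1
  · rw [Finset.prod_congr rfl (g := fun _ => a) fun i hi => by simp [Finset.mem_range.1 hi]]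
    simp
  · rw [Finset.prod_congr rfl (g := fun _ => b) fun i hi => by
      simp [(Finset.mem_Ico.1 hi).1]]
    simp

/-- The `k`-th term is a sum of `k + 1 ≤ 2^k` multilinear maps of norm at most one, which costs at
most a factor `2` in the radius. -/
theorem dividedDifferenceSeries_radius_pos {c : ℕ → ℂ} {C r : ℝ} (hC : 0 < C) (hr : 0 < r)
    (hc : ∀ k, ‖c k‖ ≤ C * r ^ k) : 0 < (dividedDifferenceSeries c).radius := by
  have hpos : (0 : ℝ) < (2 * r)⁻¹ := by positivity
  lift (2 * r)⁻¹ to NNReal using hpos.le with ρ hρ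
  refine lt_of_lt_of_le (b := (ρ : ENNReal)) (by simpa using hpos) ?_
  refine FormalMultilinearSeries.le_radius_of_bound _ (C * r) fun k => ?_
  have h1 : ‖dividedDifferenceSeries c k‖ ≤ ‖c (k + 1)‖ * (k + 1) := by
    rw [dividedDifferenceSeries, norm_smul]
    gcongr
    refine (norm_sum_le _ _).trans ?_
    refine (Finset.sum_le_card_nsmul _ _ 1 fun j _ => ?_).trans (by simp)
    refine (ContinuousMultilinearMap.norm_compContinuousLinearMap_le _ _).trans ?_
    rw [ContinuousMultilinearMap.norm_mkPiAlgebra, one_mul]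
    refine Finset.prod_le_one (fun _ _ => norm_nonneg _) fun i _ => ?_
    split_ifs
    · exact ContinuousLinearMap.norm_fst_le ℂ ℂ ℂ
    · exact ContinuousLinearMap.norm_snd_le ℂ ℂ ℂ
  have h2 : ((k : ℝ) + 1) ≤ 2 ^ k := by exact_mod_cast Nat.lt_two_pow_self
  rw [hρ]
  calc ‖dividedDifferenceSeries c k‖ * ((2 * r)⁻¹) ^ k
      ≤ (C * r ^ (k + 1) * 2 ^ k) * ((2 * r)⁻¹) ^ k := by
        gcongr
        exact h1.trans (by gcongr; exact hc _)
    _ = C * r := by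
        rw [inv_pow, mul_pow, pow_succ]; field_simp

/-- Off the diagonal, `b^(k+1) - a^(k+1) = (b - a) ∑ a^j b^(k-j)` identifies the quotient with the
sum of the divided difference series termwise. The diagonal follows by continuity. -/
theorem dslope_analyticAt {φ : ℂ → ℂ} (hφ : AnalyticAt ℂ φ 0) :
    AnalyticAt ℂ (fun z : ℂ × ℂ => dslope φ z.1 z.2) 0 := by
  obtain ⟨P, hP⟩ := hφ
  obtain ⟨R, hR⟩ := hP
  obtain ⟨C, r, hC, hr, hb⟩ := P.le_mul_pow_of_radius_pos (hR.r_pos.trans_le hR.r_le)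
  have hb' : ∀ k, ‖P.coeff k‖ ≤ C * r ^ k := fun k => by
    simpa [FormalMultilinearSeries.norm_apply_eq_norm_coef] using hb k
  set Q := dividedDifferenceSeries P.coeff with hQ
  have hQr : 0 < Q.radius := dividedDifferenceSeries_radius_pos hC hr hb'
  have hQs := Q.hasFPowerSeriesOnBall hQr
  have hnear : ∀ᶠ z : ℂ × ℂ in 𝓝 0, z ∈ Metric.eball (0 : ℂ × ℂ) Q.radius ∧
      z.1 ∈ Metric.eball (0 : ℂ) R ∧ z.2 ∈ Metric.eball (0 : ℂ) R := by
    have h1 : Metric.eball (0 : ℂ) R ∈ 𝓝 (0 : ℂ) := Metric.eball_mem_nhds _ hR.r_pos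
    have h2 : Tendsto (fun z : ℂ × ℂ => z.1) (𝓝 0) (𝓝 0) := by
      simpa using (continuous_fst (X := ℂ) (Y := ℂ)).tendsto 0
    have h3 : Tendsto (fun z : ℂ × ℂ => z.2) (𝓝 0) (𝓝 0) := by
      simpa using (continuous_snd (X := ℂ) (Y := ℂ)).tendsto 0
    exact (Filter.eventually_mem_set.2 (Metric.eball_mem_nhds _ hQr)).and
      ((h2.eventually_mem h1).and (h3.eventually_mem h1))
  have hne : ∀ z : ℂ × ℂ, z ∈ Metric.eball (0 : ℂ × ℂ) Q.radius → z.1 ∈ Metric.eball (0 : ℂ) R →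
      z.2 ∈ Metric.eball (0 : ℂ) R → z.1 ≠ z.2 → Q.sum z = dslope φ z.1 z.2 := by
    rintro ⟨a, b⟩ hz h1 h2 hab
    have s1 := (hR.hasSum h2).sub (hR.hasSum h1)
    simp only [zero_add, FormalMultilinearSeries.apply_eq_pow_smul_coeff, smul_eq_mul] at s1
    rw [← hasSum_nat_add_iff' 1] at s1
    simp only [Finset.range_one, Finset.sum_singleton, pow_zero, sub_self, sub_zero] at s1
    have s2 := hQs.hasSum hz
    simp only [zero_add] at s2
    have s3 := s1.mul_left (b - a)⁻¹
    have hba : b - a ≠ 0 := sub_ne_zero.2 (Ne.symm hab)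
    rw [dslope_of_ne _ (Ne.symm hab), slope, vsub_eq_sub, smul_eq_mul]
    refine s2.unique (s3.congr_fun ?_)
    intro k
    rw [hQ, dividedDifferenceSeries_apply, ← sub_mul, ← neg_sub (a ^ _),
      ← (Commute.all a b).geom_sum₂_mul (k + 1)]
    simp only [add_tsub_cancel_right]
    field_simp
    ring
  refine hQs.analyticAt.congr ?_
  have hev : ∀ᶠ z : ℂ × ℂ in 𝓝 0, ∀ᶠ y in 𝓝 z, y ∈ Metric.eball (0 : ℂ × ℂ) Q.radius ∧
      y.1 ∈ Metric.eball (0 : ℂ) R ∧ y.2 ∈ Metric.eball (0 : ℂ) R := hnear.eventually_nhds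
  filter_upwards [hev] with z hz
  rcases ne_or_eq z.1 z.2 with hab | hab
  · have := hz.self_of_nhds
    exact hne z this.1 this.2.1 this.2.2 hab
  obtain ⟨a, b⟩ := z
  obtain rfl : a = b := hab
  have hzz := hz.self_of_nhds
  have hd : DifferentiableAt ℂ φ a := (hR.analyticAt_of_mem hzz.2.1).differentiableAt
  have hcont : Tendsto (fun y => dslope φ a y) (𝓝[≠] a) (𝓝 (dslope φ a a)) :=
    (continuousAt_dslope_same.2 hd).tendsto.mono_left nhdsWithin_le_nhds
  have hpair : Tendsto (fun y : ℂ => (a, y)) (𝓝[≠] a) (𝓝 (a, a)) :=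
    ((continuous_const.prodMk continuous_id).tendsto a).mono_left nhdsWithin_le_nhds
  have hQc : Tendsto (fun y : ℂ => Q.sum (a, y)) (𝓝[≠] a) (𝓝 (Q.sum (a, a))) :=
    (hQs.analyticAt_of_mem hzz.1).continuousAt.tendsto.comp hpair
  -- Both diagonal values are the limit of the common values at `(a, y)` as `y → a` with `y ≠ a`.
  refine tendsto_nhds_unique hQc (hcont.congr' ?_)
  filter_upwards [hpair.eventually hz, self_mem_nhdsWithin] with y hy hya
  exact (hne _ hy.1 hy.2.1 hy.2.2 (Ne.symm hya)).symm

theorem analyticAt_comp_apply {n : ℕ} {f : ℂ → ℂ} (hf : AnalyticAt ℂ f 0) (j : Fin n) :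
    AnalyticAt ℂ (fun w : Fin n → ℂ => f (w j)) 0 :=
  AnalyticAt.fun_comp (f := fun w : Fin n → ℂ => w j) (by simpa using hf)
    ((ContinuousLinearMap.proj (R := ℂ) (φ := fun _ : Fin n => ℂ) j).analyticAt 0)

theorem dslope_pair_analyticAt {n : ℕ} {φ : ℂ → ℂ} (hφ : AnalyticAt ℂ φ 0) (i j : Fin n) :
    AnalyticAt ℂ (fun w : Fin n → ℂ => dslope φ (w i) (w j)) 0 :=
  AnalyticAt.fun_comp (g := fun z : ℂ × ℂ => dslope φ z.1 z.2)
    (f := fun w : Fin n → ℂ => (w i, w j)) (by simpa using! dslope_analyticAt hφ)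
    (((ContinuousLinearMap.proj (R := ℂ) (φ := fun _ : Fin n => ℂ) i).analyticAt 0).prod
      ((ContinuousLinearMap.proj (R := ℂ) (φ := fun _ : Fin n => ℂ) j).analyticAt 0))

theorem prod_dslope_analyticAt {n : ℕ} {φ : ℂ → ℂ} (hφ : AnalyticAt ℂ φ 0) :
    AnalyticAt ℂ (fun w : Fin n → ℂ => ∏ i, ∏ j ∈ Finset.Ioi i, dslope φ (w i) (w j)) 0 :=
  Finset.analyticAt_fun_prod _ fun i _ => Finset.analyticAt_fun_prod _ fun j _ =>
    dslope_pair_analyticAt hφ i j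

theorem prod_dslope_zero {n : ℕ} {φ : ℂ → ℂ} (hφ' : deriv φ 0 = 1) :
    ∏ i : Fin n, ∏ j ∈ Finset.Ioi i, dslope φ ((0 : Fin n → ℂ) i) ((0 : Fin n → ℂ) j) = 1 := by
  simp [hφ']

theorem prod_dslope_cpow_analyticAt {n : ℕ} {φ : ℂ → ℂ} (hφ : AnalyticAt ℂ φ 0)
    (hφ' : deriv φ 0 = 1) (ν : ℝ) : AnalyticAt ℂ (fun w : Fin n → ℂ =>
      (∏ i, ∏ j ∈ Finset.Ioi i, dslope φ (w i) (w j)) ^ (ν : ℂ)) 0 := by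
  refine AnalyticAt.cpow (prod_dslope_analyticAt hφ) analyticAt_const ?_
  rw [prod_dslope_zero hφ']
  simp

theorem comp_pi_analyticAt {n : ℕ} {φ : ℂ → ℂ} (hφ : AnalyticAt ℂ φ 0)
    {q : (Fin n → ℂ) → ℂ} (hq : AnalyticAt ℂ q (fun _ => φ 0)) :
    AnalyticAt ℂ (fun w : Fin n → ℂ => q fun j => φ (w j)) 0 :=
  AnalyticAt.fun_comp (f := fun (w : Fin n → ℂ) j => φ (w j)) (by simpa using hq)
    (analyticAt_pi_iff.2 fun j => analyticAt_comp_apply hφ j)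

/-- This concerns the amplitude itself, without splitting off `w^(lam-1)`, whose principal powers
could have cuts. The arc can thus be moved freely through the coordinate hyperplanes. -/
theorem amplitude_analyticAt {n : ℕ} {φ : ℂ → ℂ} (hφ : AnalyticAt ℂ φ 0) (hφ' : deriv φ 0 = 1)
    (ν : ℝ) {q : (Fin n → ℂ) → ℂ} (hq : AnalyticAt ℂ q (fun _ => φ 0)) :
    AnalyticAt ℂ (amplitude q ν φ) 0 :=
  ((comp_pi_analyticAt hφ hq).fun_mul (prod_dslope_cpow_analyticAt hφ hφ' ν)).fun_mul
    (Finset.analyticAt_fun_prod _ fun j _ => analyticAt_comp_apply hφ.deriv j)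

/-! ### Splitting the factor `w^(lam-1)` off the amplitude -/

theorem powSubOne_eq_prod_pow {n : ℕ} {lam : Fin n → ℝ} {d : Fin n → ℕ}
    (hd : ∀ j, lam j = d j + 1) (t : Fin n → ℂ) : powSubOne lam t = ∏ j, t j ^ d j := by
  refine Finset.prod_congr rfl fun j _ => ?_
  rw [hd j, add_sub_cancel_right, Complex.ofReal_natCast, Complex.cpow_natCast]

/-- Monodromy: on a circle about `0` in the `j`-th variable, `f` and `g` are single-valued, while
the principal power has different limits at the negative axis from the two sides when `lam j` is not
an integer. Hence `g` vanishes on the negative axis, and by the identity theorem on the whole disc.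
-/
theorem eventually_eq_zero_of_cpow_factor {n : ℕ} {f g : (Fin n → ℂ) → ℂ}
    (hf : AnalyticAt ℂ f 0) (hg : AnalyticAt ℂ g 0) {lam : Fin n → ℝ} {j : Fin n}
    (hj : ∀ d : ℤ, lam j ≠ d)
    (hfg : ∀ᶠ v in 𝓝 (0 : Fin n → ℂ), (∀ i, v i ≠ 0) → f v = powSubOne lam v * g v) :
    ∀ᶠ v in 𝓝 (0 : Fin n → ℂ), (∀ i, v i ≠ 0) → f v = 0 := by
  obtain ⟨ρ, hρ, hball⟩ := Metric.eventually_nhds_iff_ball.1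
    (hfg.and (hf.eventually_analyticAt.and hg.eventually_analyticAt))
  refine Metric.eventually_nhds_iff_ball.2 ⟨ρ, hρ, fun v hv hv0 => ?_⟩
  have hmem : ∀ z ∈ Metric.ball (0 : ℂ) ρ, Function.update v j z ∈ Metric.ball 0 ρ := by
    intro z hz
    rw [mem_ball_zero_iff] at hz hv ⊢
    rw [pi_norm_lt_iff hρ] at hv ⊢
    intro i
    rcases eq_or_ne i j with rfl | hij
    · simpa using hz
    · simpa [hij] using hv i
  have hupd : ∀ z, AnalyticAt ℂ (fun z : ℂ => Function.update v j z) z := fun z =>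
    analyticAt_pi_iff.2 fun i => by
      rcases eq_or_ne i j with rfl | hij
      · simpa using! analyticAt_id
      · simpa [hij] using analyticAt_const
  have hu : AnalyticOnNhd ℂ (fun z => g (Function.update v j z)) (Metric.ball 0 ρ) :=
    fun z hz => AnalyticAt.fun_comp (hball _ (hmem z hz)).2.2 (hupd z)
  have hF : AnalyticOnNhd ℂ (fun z => f (Function.update v j z)) (Metric.ball 0 ρ) :=
    fun z hz => AnalyticAt.fun_comp (hball _ (hmem z hz)).2.1 (hupd z)
  set a : ℝ := lam j - 1 with ha
  set c : ℂ := ∏ i ∈ Finset.univ.erase j, (v i) ^ ((lam i - 1 : ℝ) : ℂ) with hc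
  have hc0 : c ≠ 0 := Finset.prod_ne_zero_iff.2 fun i _ => by
    rw [Complex.cpow_ne_zero_iff]; exact Or.inl (hv0 i)
  have hrel : ∀ z ∈ Metric.ball (0 : ℂ) ρ, z ≠ 0 →
      f (Function.update v j z) = z ^ (a : ℂ) * c * g (Function.update v j z) := by
    intro z hz hz0
    rw [(hball _ (hmem z hz)).1, powSubOne, ← Finset.mul_prod_erase _ _ (Finset.mem_univ j)]
    · simp only [Function.update_self]
      congr 2
      refine Finset.prod_congr rfl fun i hi => ?_
      rw [Function.update_of_ne (Finset.ne_of_mem_erase hi)]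
    · intro i
      rcases eq_or_ne i j with rfl | hij
      · simpa using hz0
      · simpa [hij] using hv0 i
  have hzero : ∀ x : ℝ, 0 < x → x < ρ → g (Function.update v j (-x : ℂ)) = 0 := by
    intro x hx hxρ
    have hzb : ∀ θ : ℝ, (x * Complex.exp (θ * Complex.I) : ℂ) ∈ Metric.ball (0 : ℂ) ρ := by
      intro θ
      rw [mem_ball_zero_iff, norm_mul, Complex.norm_exp_ofReal_mul_I, mul_one,
        Complex.norm_real, Real.norm_of_nonneg hx.le]
      exact hxρ
    have hθ : ∀ θ ∈ Set.Ioc (-Real.pi) Real.pi,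
        f (Function.update v j (x * Complex.exp (θ * Complex.I))) =
          Complex.exp ((Real.log x + θ * Complex.I) * a) * c *
            g (Function.update v j (x * Complex.exp (θ * Complex.I))) := by
      intro θ hθ
      have hne : (x * Complex.exp (θ * Complex.I) : ℂ) ≠ 0 :=
        mul_ne_zero (by exact_mod_cast hx.ne') (Complex.exp_ne_zero _)
      rw [hrel _ (hzb θ) hne, Complex.cpow_def_of_ne_zero hne,
        Complex.log_ofReal_mul hx (Complex.exp_ne_zero _), Complex.log_exp (by simpa using hθ.1)
          (by simpa using hθ.2)]
    have hcont : ∀ G : ℂ → ℂ, AnalyticOnNhd ℂ G (Metric.ball 0 ρ) →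
        Continuous fun θ : ℝ => G (x * Complex.exp (θ * Complex.I)) := fun G hG =>
      hG.continuousOn.comp_continuous (by fun_prop) hzb
    -- Principal arguments fill `(-π, π]`: the formula holds at `π` itself but at `-π` only as a
    -- one-sided limit.
    have hlim := tendsto_nhds_unique_of_eventuallyEq
      (((hcont _ hF).tendsto (-Real.pi)).mono_left nhdsWithin_le_nhds)
      (((Continuous.mul (by fun_prop : Continuous fun θ : ℝ =>
        Complex.exp ((Real.log x + θ * Complex.I) * a) * c) (hcont _ hu)).tendsto
          (-Real.pi)).mono_left nhdsWithin_le_nhds)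
      (l := 𝓝[>] (-Real.pi)) (by
        filter_upwards [Ioc_mem_nhdsGT (by linarith [Real.pi_pos] : -Real.pi < Real.pi)] with θ h
        exact hθ θ h)
    have hat := hθ Real.pi ⟨by linarith [Real.pi_pos], le_rfl⟩
    have e1 : Complex.exp ((Real.pi : ℂ) * Complex.I) = -1 := Complex.exp_pi_mul_I
    have e2 : Complex.exp (((-Real.pi : ℝ) : ℂ) * Complex.I) = -1 := by
      push_cast
      rw [neg_mul, Complex.exp_neg, e1]; norm_num
    simp only [Pi.mul_apply, e1, e2, mul_neg, mul_one] at hlim hat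
    by_contra hgne
    rw [hlim] at hat
    have h3 := mul_right_cancel₀ hc0 (mul_right_cancel₀ hgne hat)
    rw [Complex.exp_eq_exp_iff_exists_int] at h3
    obtain ⟨k, hk⟩ := h3
    have h4 := congrArg Complex.im hk
    simp at h4
    refine hj (1 - k) ?_
    have h5 : (a + k) * Real.pi = 0 := by linarith
    have h6 : a + k = 0 := (mul_eq_zero.1 h5).resolve_right Real.pi_ne_zero
    push_cast
    linarith
  have hρ2 : ((-(ρ / 2) : ℝ) : ℂ) ∈ Metric.ball (0 : ℂ) ρ := by
    rw [mem_ball_zero_iff, Complex.norm_real, Real.norm_eq_abs, abs_neg, abs_of_pos (by linarith)]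
    linarith
  have hfreq : ∃ᶠ z in 𝓝[≠] (((-(ρ / 2) : ℝ)) : ℂ), g (Function.update v j z) = 0 := by
    have ht : Tendsto (fun x : ℝ => ((-x : ℝ) : ℂ)) (𝓝[≠] (ρ / 2))
        (𝓝[≠] (((-(ρ / 2) : ℝ)) : ℂ)) := by
      refine tendsto_nhdsWithin_iff.2 ⟨((by fun_prop : Continuous fun x : ℝ =>
        ((-x : ℝ) : ℂ)).tendsto _).mono_left nhdsWithin_le_nhds, ?_⟩
      filter_upwards [self_mem_nhdsWithin] with x hx
      have hx' : x ≠ ρ / 2 := hx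
      have : ((-x : ℝ) : ℂ) ≠ ((-(ρ / 2) : ℝ) : ℂ) := by
        rwa [Ne, Complex.ofReal_inj, neg_inj]
      exact this
    refine ht.frequently (Eventually.frequently ?_)
    filter_upwards [mem_nhdsWithin_of_mem_nhds
      (Ioo_mem_nhds (by linarith : (0 : ℝ) < ρ / 2) (by linarith : ρ / 2 < ρ))] with x hx
    simpa using hzero x hx.1 hx.2
  have hall := hu.eqOn_zero_of_preconnected_of_frequently_eq_zero
    (convex_ball (0 : ℂ) ρ).isPreconnected hρ2 hfreq
  have hvj : v j ∈ Metric.ball (0 : ℂ) ρ := by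
    rw [mem_ball_zero_iff] at hv ⊢
    exact (norm_le_pi_norm v j).trans_lt hv
  have := hall hvj
  simp only [Function.update_eq_self, Pi.zero_apply] at this
  rw [(hball v hv).1 hv0, this, mul_zero]

theorem sub_eq_mul_dslope (φ : ℂ → ℂ) (a b : ℂ) : φ b - φ a = (b - a) * dslope φ a b := by
  simpa using (sub_smul_dslope φ a b).symm

/-- For integral exponents `φ(w_j) - φ(0) = w_j · dslope φ 0 w_j` turns powers of `t_j - x₀` into
powers of `w_j` times an analytic factor. -/
theorem amplitude_factor {n : ℕ} {φ : ℂ → ℂ} (hφ : AnalyticAt ℂ φ 0) (hφ' : deriv φ 0 = 1)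
    (ν : ℝ) {q g : (Fin n → ℂ) → ℂ} (hq : AnalyticAt ℂ q (fun _ => φ 0)) (hg : AnalyticAt ℂ g 0)
    {lam : Fin n → ℝ} (hlam : ∀ j, 0 < lam j)
    (hqg : ∀ᶠ t in 𝓝 (fun _ : Fin n => φ 0), (∀ j, t j ≠ φ 0) →
      q t = powSubOne lam (fun j => t j - φ 0) * g (fun j => t j - φ 0)) :
    ∃ F : (Fin n → ℂ) → ℂ, AnalyticAt ℂ F 0 ∧ ∀ᶠ w in 𝓝 (0 : Fin n → ℂ), (∀ j, w j ≠ 0) →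
      amplitude q ν φ w = powSubOne lam w * F w := by
  have hφn : Tendsto (fun (w : Fin n → ℂ) j => φ (w j)) (𝓝 0) (𝓝 fun _ => φ 0) :=
    tendsto_pi_nhds.2 fun j => by
      simpa using (analyticAt_comp_apply hφ j).continuousAt.tendsto
  have hds : AnalyticAt ℂ (dslope φ 0) 0 :=
    AnalyticAt.fun_comp (g := fun z : ℂ × ℂ => dslope φ z.1 z.2) (f := fun v : ℂ => (0, v))
      (by simpa using! dslope_analyticAt hφ) (analyticAt_const.prod analyticAt_id)
  have hds0 : ∀ᶠ w in 𝓝 (0 : Fin n → ℂ), ∀ j, dslope φ 0 (w j) ≠ 0 :=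
    eventually_all.2 fun j => (analyticAt_comp_apply hds j).continuousAt.eventually_ne
      (by simp [hφ'])
  have hne : ∀ᶠ w in 𝓝 (0 : Fin n → ℂ), (∀ j, w j ≠ 0) → ∀ j, φ (w j) ≠ φ 0 := by
    filter_upwards [hds0] with w hw hw0 j
    rw [← sub_ne_zero, sub_eq_mul_dslope, sub_zero]
    exact mul_ne_zero (hw0 j) (hw j)
  by_cases hint : ∀ j, ∃ d : ℤ, lam j = d
  · have : ∀ j, ∃ d : ℕ, lam j = d + 1 := fun j => by
      obtain ⟨d, hd⟩ := hint j
      have h0 : (0 : ℝ) < d := hd ▸ hlam j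
      have h1 : 0 < d := by exact_mod_cast h0
      refine ⟨(d - 1).toNat, ?_⟩
      have : (((d - 1).toNat : ℤ) : ℝ) = ((d - 1 : ℤ) : ℝ) := by
        rw [Int.toNat_of_nonneg (by omega)]
      rw [hd, ← Int.cast_natCast, this]
      push_cast; ring
    choose d hd using this
    refine ⟨fun w => (∏ j, dslope φ 0 (w j) ^ d j) * g (fun j => φ (w j) - φ 0) *
      (∏ i, ∏ j ∈ Finset.Ioi i, dslope φ (w i) (w j)) ^ (ν : ℂ) * ∏ j, deriv φ (w j), ?_, ?_⟩
    · refine AnalyticAt.fun_mul (AnalyticAt.fun_mul (AnalyticAt.fun_mul ?_ ?_)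
        (prod_dslope_cpow_analyticAt hφ hφ' ν))
        (Finset.analyticAt_fun_prod _ fun j _ => analyticAt_comp_apply hφ.deriv j)
      · exact Finset.analyticAt_fun_prod _ fun j _ => (analyticAt_comp_apply hds j).fun_pow _
      · refine comp_pi_analyticAt (φ := fun v => φ v - φ 0) (hφ.fun_sub analyticAt_const) ?_
        simpa using! hg
    · filter_upwards [hφn.eventually hqg, hne] with w h1 h2 h0
      rw [amplitude, h1 (h2 h0), powSubOne_eq_prod_pow hd, powSubOne_eq_prod_pow hd]
      have : ∀ j, (φ (w j) - φ 0) ^ d j = w j ^ d j * dslope φ 0 (w j) ^ d j := fun j => by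
        rw [sub_eq_mul_dslope, sub_zero, mul_pow]
      simp only [this, Finset.prod_mul_distrib]
      ring
  · push Not at hint
    obtain ⟨j, hj⟩ := hint
    -- A non-integral exponent makes `q` vanish near `t₀` off the hyperplanes, so `F = 0` serves.
    refine ⟨0, analyticAt_const, ?_⟩
    have htr : Tendsto (fun (v : Fin n → ℂ) j => φ 0 + v j) (𝓝 0) (𝓝 fun _ => φ 0) := by
      refine tendsto_pi_nhds.2 fun j => ?_
      simpa using (tendsto_const_nhds (x := φ 0)).add ((continuous_apply j).tendsto (0 : Fin n → ℂ))
    have hz := eventually_eq_zero_of_cpow_factor (lam := lam) (j := j)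
      (f := fun v => q fun j => φ 0 + v j)
      (comp_pi_analyticAt (φ := fun v => φ 0 + v) (analyticAt_const.fun_add analyticAt_id)
        (by simpa using hq)) hg hj (by
        filter_upwards [htr.eventually hqg] with v hv hv0
        simpa using hv (by simpa using hv0))
    have hback : Tendsto (fun (w : Fin n → ℂ) j => φ (w j) - φ 0) (𝓝 0) (𝓝 0) := by
      refine tendsto_pi_nhds.2 fun j => ?_
      simpa using ((tendsto_pi_nhds.1 hφn j).sub_const (φ 0))
    filter_upwards [hback.eventually hz, hne] with w h1 h2 h0
    have : q (fun j => φ (w j)) = 0 := by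
      simpa using h1 fun i => sub_ne_zero.2 (h2 h0 i)
    simp [amplitude, this]

/-! ### Homogeneous terms and uniform approximation by polynomials -/

/-- The `k`-th term of a power series in `n` variables as a homogeneous polynomial. -/
noncomputable def seriesTerm {n : ℕ} (P : FormalMultilinearSeries ℂ (Fin n → ℂ) ℂ) (k : ℕ) :
    MvPolynomial (Fin n) ℂ :=
  ∑ f : Fin k → Fin n, MvPolynomial.C (P k fun i => Pi.single (f i) 1) *
    ∏ i, MvPolynomial.X (f i)

theorem seriesTerm_isHomogeneous {n : ℕ} (P : FormalMultilinearSeries ℂ (Fin n → ℂ) ℂ) (k : ℕ) :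
    (seriesTerm P k).IsHomogeneous k := by
  refine MvPolynomial.IsHomogeneous.sum _ _ _ fun f _ => ?_
  refine MvPolynomial.IsHomogeneous.C_mul ?_ _
  simpa using MvPolynomial.IsHomogeneous.prod Finset.univ (fun i => MvPolynomial.X (R := ℂ) (f i))
    (fun _ => 1) fun i _ => MvPolynomial.isHomogeneous_X ℂ (f i)

theorem eval_seriesTerm {n : ℕ} (P : FormalMultilinearSeries ℂ (Fin n → ℂ) ℂ) (k : ℕ)
    (w : Fin n → ℂ) : MvPolynomial.eval w (seriesTerm P k) = P k fun _ => w := by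
  have hw : w = ∑ j, w j • (Pi.single j 1 : Fin n → ℂ) := by
    funext i
    simp [Finset.sum_apply, Pi.single_apply]
  conv_rhs => rw [hw]
  rw [ContinuousMultilinearMap.map_sum, seriesTerm, map_sum]
  refine Finset.sum_congr rfl fun f _ => ?_
  rw [ContinuousMultilinearMap.map_smul_univ]
  simp [map_prod, mul_comm]

theorem eval_sum_seriesTerm {n : ℕ} (P : FormalMultilinearSeries ℂ (Fin n → ℂ) ℂ) (m : ℕ)
    (w : Fin n → ℂ) :
    MvPolynomial.eval w (∑ k ∈ Finset.range m, seriesTerm P k) = P.partialSum m w := by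
  rw [map_sum, FormalMultilinearSeries.partialSum]
  exact Finset.sum_congr rfl fun k _ => eval_seriesTerm P k w

/-- `G` is a uniform limit of polynomials on `K`. -/
def PolyApprox {n : ℕ} (K : Set (Fin n → ℂ)) (G : (Fin n → ℂ) → ℂ) : Prop :=
  ∀ ε > 0, ∃ P : MvPolynomial (Fin n) ℂ, ∀ w ∈ K, ‖G w - MvPolynomial.eval w P‖ ≤ ε

theorem continuous_eval_mvPolynomial {n : ℕ} (P : MvPolynomial (Fin n) ℂ) :
    Continuous fun w => MvPolynomial.eval w P :=
  MvPolynomial.continuous_eval P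

theorem exists_bound_eval {n : ℕ} (P : MvPolynomial (Fin n) ℂ) (r : ℝ) :
    ∃ M > 0, ∀ w ∈ Metric.ball (0 : Fin n → ℂ) r, ‖MvPolynomial.eval w P‖ ≤ M := by
  obtain ⟨M, hM⟩ := (isCompact_closedBall (0 : Fin n → ℂ) r).exists_bound_of_continuousOn
    (continuous_eval_mvPolynomial P).continuousOn
  exact ⟨max M 1, by positivity, fun w hw =>
    (hM w (Metric.ball_subset_closedBall hw)).trans (le_max_left _ _)⟩

theorem PolyApprox.exists_bound {n : ℕ} {r : ℝ} {G : (Fin n → ℂ) → ℂ}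
    (hG : PolyApprox (Metric.ball 0 r) G) :
    ∃ M > 0, ∀ w ∈ Metric.ball (0 : Fin n → ℂ) r, ‖G w‖ ≤ M := by
  obtain ⟨P, hP⟩ := hG 1 one_pos
  obtain ⟨M, hM, hb⟩ := exists_bound_eval P r
  refine ⟨M + 1, by positivity, fun w hw => ?_⟩
  have := norm_add_le (G w - MvPolynomial.eval w P) (MvPolynomial.eval w P)
  rw [sub_add_cancel] at this
  linarith [hP w hw, hb w hw]

theorem PolyApprox.continuousOn {n : ℕ} {K : Set (Fin n → ℂ)} {G : (Fin n → ℂ) → ℂ}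
    (hG : PolyApprox K G) : ContinuousOn G K := by
  refine continuousOn_of_uniform_approx_of_continuousOn fun u hu => ?_
  obtain ⟨ε, hε, hεu⟩ := Metric.mem_uniformity_dist.1 hu
  obtain ⟨P, hP⟩ := hG (ε / 2) (by positivity)
  refine ⟨_, (continuous_eval_mvPolynomial P).continuousOn, fun y hy => hεu ?_⟩
  rw [dist_eq_norm]
  linarith [hP y hy]

/-- Allows the exponential, `h ∘ Δ` and the amplitude to be approximated separately. -/
theorem PolyApprox.mul {n : ℕ} {r : ℝ} {G H : (Fin n → ℂ) → ℂ}
    (hG : PolyApprox (Metric.ball 0 r) G) (hH : PolyApprox (Metric.ball 0 r) H) :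
    PolyApprox (Metric.ball 0 r) fun w => G w * H w := by
  intro ε hε
  obtain ⟨M, hM, hGb⟩ := hG.exists_bound
  -- `Q` is fixed before `P`, because the tolerance for `P` depends on the bound `B` of `Q`.
  obtain ⟨Q, hQ⟩ := hH (ε / 2 / M) (by positivity)
  obtain ⟨B, hB, hQb⟩ := exists_bound_eval Q r
  obtain ⟨P, hP⟩ := hG (ε / 2 / B) (by positivity)
  refine ⟨P * Q, fun w hw => ?_⟩
  rw [map_mul, show G w * H w - MvPolynomial.eval w P * MvPolynomial.eval w Q =
    G w * (H w - MvPolynomial.eval w Q) + (G w - MvPolynomial.eval w P) * MvPolynomial.eval w Q by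
      ring]
  calc _ ≤ M * (ε / 2 / M) + (ε / 2 / B) * B := by
        refine (norm_add_le _ _).trans ?_
        rw [norm_mul, norm_mul]
        gcongr
        exacts [hGb w hw, hQ w hw, hP w hw, hQb w hw]
    _ = ε := by field_simp; ring

theorem PolyApprox.of_hasFPowerSeriesOnBall {n : ℕ} {G : (Fin n → ℂ) → ℂ}
    {P : FormalMultilinearSeries ℂ (Fin n → ℂ) ℂ} {R : ENNReal}
    (hG : HasFPowerSeriesOnBall G P 0 R) {r : NNReal} (hr : (r : ENNReal) < R) :
    PolyApprox (Metric.ball 0 r) G := by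
  intro ε hε
  have h := Metric.tendstoUniformlyOn_iff.1 (hG.tendstoUniformlyOn hr) ε hε
  obtain ⟨m, hm⟩ := h.exists
  refine ⟨∑ k ∈ Finset.range m, seriesTerm P k, fun w hw => ?_⟩
  rw [eval_sum_seriesTerm, ← dist_eq_norm]
  simpa using (hm w hw).le

theorem PolyApprox.entire_comp {n : ℕ} {f : ℂ → ℂ} (hf : Differentiable ℂ f)
    (P : MvPolynomial (Fin n) ℂ) (r : ℝ) :
    PolyApprox (Metric.ball 0 r) fun w => f (MvPolynomial.eval w P) := by
  intro ε hε
  obtain ⟨M, hM, hb⟩ := exists_bound_eval P r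
  -- The radius `1` only selects the circle that defines the Cauchy coefficients. The series
  -- converges everywhere, hence uniformly on a disc containing the range of the polynomial.
  have hs := hf.hasFPowerSeriesOnBall 0 (R := 1) one_pos
  have h := Metric.tendstoUniformlyOn_iff.1
    (hs.tendstoUniformlyOn (r' := ⟨M + 1, by positivity⟩) ENNReal.coe_lt_top) ε hε
  obtain ⟨m, hm⟩ := h.exists
  refine ⟨∑ k ∈ Finset.range m, MvPolynomial.C ((cauchyPowerSeries f 0 ((1 : NNReal) : ℝ)).coeff k) * P ^ k,
    fun w hw => ?_⟩
  have hw' : MvPolynomial.eval w P ∈ Metric.ball (0 : ℂ) (M + 1) := by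
    rw [mem_ball_zero_iff]; linarith [hb w hw]
  have := (hm _ hw').le
  rw [dist_eq_norm, zero_add, FormalMultilinearSeries.partialSum] at this
  simpa [map_sum, FormalMultilinearSeries.apply_eq_pow_smul_coeff, mul_comm] using this

/-! ### Cauchy's theorem in a polydisk -/

/-- `c` is an arc in the disk of radius `r`, parametrized by `[a, b]`, along which the fundamental
theorem of calculus holds. -/
structure IsArcInDisk (c : ℝ → ℂ) (a b r : ℝ) : Prop where
  le : a ≤ b
  cont : ContinuousOn c (Set.Icc a b)
  integrable : IntegrableOn (deriv c) (Set.Icc a b)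
  differentiable : ∃ E : Set ℝ, E.Countable ∧ ∀ s ∈ Set.Ioo a b \ E, DifferentiableAt ℝ c s
  mem : ∀ s ∈ Set.Icc a b, ‖c s‖ < r

/-- The parameter box `[a, b]ⁿ`. -/
def paramBox (n : ℕ) (a b : ℝ) : Set (Fin n → ℝ) := Set.univ.pi fun _ => Set.Icc a b

theorem measurableSet_paramBox (n : ℕ) (a b : ℝ) : MeasurableSet (paramBox n a b) :=
  MeasurableSet.univ_pi fun _ => measurableSet_Icc

theorem volume_restrict_paramBox (n : ℕ) (a b : ℝ) :
    (volume : Measure (Fin n → ℝ)).restrict (paramBox n a b) =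
      Measure.pi fun _ => (volume : Measure ℝ).restrict (Set.Icc a b) := by
  rw [volume_pi, paramBox, Measure.restrict_pi_pi]

namespace IsArcInDisk

variable {c : ℝ → ℂ} {a b r : ℝ}

theorem integral_pow_mul_deriv (hc : IsArcInDisk c a b r) (k : ℕ) :
    ∫ s in Set.Icc a b, c s ^ k * deriv c s = (c b ^ (k + 1) - c a ^ (k + 1)) / (k + 1) := by
  obtain ⟨E, hE, hd⟩ := hc.differentiable
  have hi : IntegrableOn (fun s => c s ^ k * deriv c s) (Set.Icc a b) :=
    hc.integrable.continuousOn_mul (hc.cont.pow k) isCompact_Icc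
  have hk : ((k : ℂ) + 1) ≠ 0 := by exact_mod_cast k.succ_ne_zero
  rw [integral_Icc_eq_integral_Ioc, ← intervalIntegral.integral_of_le hc.le,
    integral_eq_of_hasDerivAt_off_countable_of_le (fun s => c s ^ (k + 1) / (k + 1)) _ hc.le hE
      ((hc.cont.pow _).div_const _) _
      ((intervalIntegrable_iff_integrableOn_Icc_of_le hc.le).2 hi)]
  · ring
  · intro s hs
    have := ((hd s hs).hasDerivAt.fun_pow (k + 1)).div_const ((k : ℂ) + 1)
    refine this.congr_deriv ?_
    push_cast
    field_simp

theorem norm_comp_lt {n : ℕ} (hc : IsArcInDisk c a b r) (hr : 0 < r) {s : Fin n → ℝ}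
    (hs : s ∈ paramBox n a b) : (fun j => c (s j)) ∈ Metric.ball (0 : Fin n → ℂ) r := by
  rw [mem_ball_zero_iff, pi_norm_lt_iff hr]
  exact fun j => hc.mem _ (hs j (Set.mem_univ j))

theorem integrable_prod_deriv (n : ℕ) (hc : IsArcInDisk c a b r) :
    IntegrableOn (fun s : Fin n → ℝ => ∏ j, deriv c (s j)) (paramBox n a b) := by
  rw [IntegrableOn, volume_restrict_paramBox]
  exact Integrable.fintype_prod fun _ => hc.integrable

theorem integrableOn_contourIntegrand {n : ℕ} (hc : IsArcInDisk c a b r) (hr : 0 < r)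
    {G : (Fin n → ℂ) → ℂ} (hG : PolyApprox (Metric.ball 0 r) G) :
    IntegrableOn (contourIntegrand c G) (paramBox n a b) := by
  obtain ⟨M, hM, hb⟩ := hG.exists_bound
  refine Integrable.bdd_mul (c := M) (hc.integrable_prod_deriv n) ?_ ?_
  · refine ContinuousOn.aestronglyMeasurable ?_ (measurableSet_paramBox n a b)
    refine hG.continuousOn.comp (continuousOn_pi.2 fun j => ?_) fun s hs => hc.norm_comp_lt hr hs
    exact hc.cont.comp (continuous_apply j).continuousOn fun s hs => hs j (Set.mem_univ j)
  · refine (ae_restrict_iff' (measurableSet_paramBox n a b)).2 (ae_of_all _ fun s hs => ?_)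
    exact hb _ (hc.norm_comp_lt hr hs)

/-- Each monomial splits into one-variable integrals with explicit primitives. The right side
involves only the endpoints of the arc, which is what makes the integral path-independent. -/
theorem integral_contourIntegrand_eval {n : ℕ} (hc : IsArcInDisk c a b r)
    (P : MvPolynomial (Fin n) ℂ) :
    ∫ s in paramBox n a b, contourIntegrand c (fun w => MvPolynomial.eval w P) s =
      ∑ d ∈ P.support, P.coeff d *
        ∏ j, (c b ^ (d j + 1) - c a ^ (d j + 1)) / ((d j : ℂ) + 1) := by
  have he : ∀ s : Fin n → ℝ, contourIntegrand c (fun w => MvPolynomial.eval w P) s =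
      ∑ d ∈ P.support, P.coeff d * ∏ j, (c (s j) ^ d j * deriv c (s j)) := fun s => by
    rw [contourIntegrand, MvPolynomial.eval_eq', Finset.sum_mul]
    refine Finset.sum_congr rfl fun d _ => ?_
    rw [Finset.prod_mul_distrib, mul_assoc]
  simp only [he]
  rw [volume_restrict_paramBox, integral_finsetSum]
  · refine Finset.sum_congr rfl fun d _ => ?_
    rw [integral_const_mul, integral_fintype_prod_eq_prod (fun j s => c s ^ d j * deriv c s)]
    congr 1
    exact Finset.prod_congr rfl fun j _ => hc.integral_pow_mul_deriv _
  · intro d _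
    refine Integrable.const_mul ?_ _
    exact Integrable.fintype_prod_dep (f := fun j s => c s ^ d j * deriv c s) fun j =>
      hc.integrable.continuousOn_mul (hc.cont.pow _) isCompact_Icc

theorem norm_integral_sub_le {n : ℕ} (hc : IsArcInDisk c a b r) (hr : 0 < r)
    {G : (Fin n → ℂ) → ℂ} (hG : PolyApprox (Metric.ball 0 r) G) {P : MvPolynomial (Fin n) ℂ}
    {ε : ℝ} (hP : ∀ w ∈ Metric.ball (0 : Fin n → ℂ) r, ‖G w - MvPolynomial.eval w P‖ ≤ ε) :
    ‖(∫ s in paramBox n a b, contourIntegrand c G s) -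
        ∫ s in paramBox n a b, contourIntegrand c (fun w => MvPolynomial.eval w P) s‖ ≤
      ε * ∫ s in paramBox n a b, ‖∏ j, deriv c (s j)‖ := by
  have hPa : PolyApprox (Metric.ball 0 r) fun w => MvPolynomial.eval w P :=
    fun ε hε => ⟨P, fun w _ => by simpa using hε.le⟩
  rw [← integral_sub (hc.integrableOn_contourIntegrand hr hG)
    (hc.integrableOn_contourIntegrand hr hPa), ← integral_const_mul]
  refine norm_integral_le_of_norm_le ((hc.integrable_prod_deriv n).norm.const_mul ε) ?_
  refine (ae_restrict_iff' (measurableSet_paramBox n a b)).2 (ae_of_all _ fun s hs => ?_)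
  rw [contourIntegrand, contourIntegrand, ← sub_mul, norm_mul]
  gcongr
  exact hP _ (hc.norm_comp_lt hr hs)

/-- **Cauchy's theorem** in a polydisk: iterated contour integrals of a uniform limit of
polynomials depend only on the endpoints of the arc. -/
theorem integral_contourIntegrand_eq {n : ℕ} {c' : ℝ → ℂ} {a' b' : ℝ}
    (hc : IsArcInDisk c a b r) (hc' : IsArcInDisk c' a' b' r) (hr : 0 < r)
    (ha : c a = c' a') (hb : c b = c' b')
    {G : (Fin n → ℂ) → ℂ} (hG : PolyApprox (Metric.ball 0 r) G) :
    ∫ s in paramBox n a b, contourIntegrand c G s =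
      ∫ s in paramBox n a' b', contourIntegrand c' G s := by
  set M := ∫ s in paramBox n a b, ‖∏ j, deriv c (s j)‖
  set M' := ∫ s in paramBox n a' b', ‖∏ j, deriv c' (s j)‖
  have hM : 0 ≤ M := integral_nonneg fun _ => norm_nonneg _
  have hM' : 0 ≤ M' := integral_nonneg fun _ => norm_nonneg _
  refine eq_of_forall_dist_le fun ε hε => ?_
  -- One polynomial serves both arcs; the `+ 1` keeps the denominator positive.
  obtain ⟨P, hP⟩ := hG (ε / (M + M' + 1)) (by positivity)
  have h1 := hc.norm_integral_sub_le hr hG hP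
  have h2 := hc'.norm_integral_sub_le hr hG hP
  rw [hc.integral_contourIntegrand_eval, ← dist_eq_norm] at h1
  rw [hc'.integral_contourIntegrand_eval, ← dist_eq_norm, ← ha, ← hb] at h2
  refine (dist_triangle_right _ _ _).trans ((add_le_add h1 h2).trans ?_)
  rw [← mul_add, div_mul_eq_mul_div, div_le_iff₀ (by positivity)]
  exact mul_le_mul_of_nonneg_left (lt_add_one (M + M')).le hε.le

end IsArcInDisk

/-! ### The two rays and absolute convergence along them -/

/-- The derivative of `rayPath κ₁ κ₂` away from `0`. -/
noncomputable def rayDeriv (κ₁ κ₂ : ℂ) (r : ℝ) : ℂ := if r < 0 then -κ₁ else κ₂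

theorem measurable_rayPath (κ₁ κ₂ : ℂ) : Measurable (rayPath κ₁ κ₂) := by
  unfold rayPath
  exact Measurable.ite measurableSet_Iio (by fun_prop) (by fun_prop)

theorem measurable_rayDeriv (κ₁ κ₂ : ℂ) : Measurable (rayDeriv κ₁ κ₂) := by
  unfold rayDeriv
  exact Measurable.ite measurableSet_Iio (by fun_prop) (by fun_prop)

theorem hasDerivAt_rayPath (κ₁ κ₂ : ℂ) {r : ℝ} (hr : r ≠ 0) :
    HasDerivAt (rayPath κ₁ κ₂) (rayDeriv κ₁ κ₂ r) r := by
  have h1 : HasDerivAt (fun r : ℝ => (r : ℂ)) 1 r := Complex.ofRealCLM.hasDerivAt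
  rcases lt_or_gt_of_ne hr with h | h
  · have h2 : HasDerivAt (fun r : ℝ => ((-r : ℝ) : ℂ) * κ₁) (-κ₁) r := by
      simpa using h1.fun_neg.mul_const κ₁
    rw [rayDeriv, if_pos h]
    refine h2.congr_of_eventuallyEq ?_
    filter_upwards [Iio_mem_nhds h] with x hx
    rw [rayPath, if_pos (show x < 0 from hx)]
  · have h2 : HasDerivAt (fun r : ℝ => (r : ℂ) * κ₂) κ₂ r := by
      simpa using h1.mul_const κ₂
    rw [rayDeriv, if_neg h.not_gt]
    refine h2.congr_of_eventuallyEq ?_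
    filter_upwards [Ioi_mem_nhds h] with x hx
    rw [rayPath, if_neg (not_lt_of_gt (show 0 < x from hx))]

theorem continuous_rayPath (κ₁ κ₂ : ℂ) : Continuous (rayPath κ₁ κ₂) := by
  refine continuous_iff_continuousAt.2 fun r => ?_
  unfold rayPath
  exact (Continuous.if_le (f' := fun r : ℝ => (r : ℂ) * κ₂) (g' := fun r : ℝ => ((-r : ℝ) : ℂ) * κ₁)
    (f := fun _ => (0 : ℝ)) (g := fun r : ℝ => r) (by fun_prop) (by fun_prop) (by fun_prop)
    (by fun_prop) (by rintro x rfl; simp)).continuousAt.congr (by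
      refine Eventually.of_forall fun x => ?_
      by_cases hx : x < 0
      · simp [hx, not_le.2 hx]
      · simp [hx, not_lt.1 hx])

theorem norm_rayPath_le {κ₁ κ₂ : ℂ} {κ : ℝ} (h₁ : ‖κ₁‖ ≤ κ) (h₂ : ‖κ₂‖ ≤ κ) (r : ℝ) :
    ‖rayPath κ₁ κ₂ r‖ ≤ κ * |r| := by
  rw [rayPath, mul_comm κ]
  split_ifs
  · rw [norm_mul, Complex.norm_real, Real.norm_eq_abs, abs_neg]; gcongr
  · rw [norm_mul, Complex.norm_real, Real.norm_eq_abs]; gcongr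

theorem norm_rayDeriv_le {κ₁ κ₂ : ℂ} {κ : ℝ} (h₁ : ‖κ₁‖ ≤ κ) (h₂ : ‖κ₂‖ ≤ κ) (r : ℝ) :
    ‖rayDeriv κ₁ κ₂ r‖ ≤ κ := by
  rw [rayDeriv]
  split_ifs
  · rwa [norm_neg]
  · exact h₂

theorem rayPath_mul (κ₁ κ₂ : ℂ) {c : ℝ} (hc : 0 < c) (r : ℝ) :
    rayPath κ₁ κ₂ (c * r) = c * rayPath κ₁ κ₂ r := by
  simp only [rayPath, mul_neg_iff, hc, hc.not_gt, false_and, or_false, true_and]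
  split_ifs <;> push_cast <;> ring

theorem rayDeriv_mul (κ₁ κ₂ : ℂ) {c : ℝ} (hc : 0 < c) (r : ℝ) :
    rayDeriv κ₁ κ₂ (c * r) = rayDeriv κ₁ κ₂ r := by
  simp only [rayDeriv, mul_neg_iff, hc, hc.not_gt, false_and, or_false, true_and]

theorem rayPath_ne_zero {κ₁ κ₂ : ℂ} (h₁ : κ₁ ≠ 0) (h₂ : κ₂ ≠ 0) {r : ℝ} (hr : r ≠ 0) :
    rayPath κ₁ κ₂ r ≠ 0 := by
  rw [rayPath]
  split_ifs
  · exact mul_ne_zero (by simpa using hr) h₁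
  · exact mul_ne_zero (by simpa using hr) h₂

theorem ae_forall_ne_zero (n : ℕ) : ∀ᵐ s : Fin n → ℝ, ∀ j, s j ≠ 0 :=
  ae_all_iff.2 fun j => Measure.ae_eval_ne (μ := fun _ : Fin n => (volume : Measure ℝ)) j 0

theorem contourIntegrand_rayPath_ae {n : ℕ} (κ₁ κ₂ : ℂ) (G : (Fin n → ℂ) → ℂ) :
    contourIntegrand (rayPath κ₁ κ₂) G =ᵐ[volume] fun s =>
      G (fun j => rayPath κ₁ κ₂ (s j)) * ∏ j, rayDeriv κ₁ κ₂ (s j) := by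
  filter_upwards [ae_forall_ne_zero n] with s hs
  rw [contourIntegrand]
  congr 1
  exact Finset.prod_congr rfl fun j _ => (hasDerivAt_rayPath κ₁ κ₂ (hs j)).deriv

theorem isArcInDisk_rayPath {κ₁ κ₂ : ℂ} {r : ℝ} (h₁ : ‖κ₁‖ < r) (h₂ : ‖κ₂‖ < r) :
    IsArcInDisk (rayPath κ₁ κ₂) (-1) 1 r where
  le := by norm_num
  cont := (continuous_rayPath κ₁ κ₂).continuousOn
  integrable := by
    have : (deriv (rayPath κ₁ κ₂)) =ᵐ[volume] rayDeriv κ₁ κ₂ := by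
      filter_upwards [Measure.ae_ne volume (0 : ℝ)] with x hx
      exact (hasDerivAt_rayPath κ₁ κ₂ hx).deriv
    refine Integrable.congr ?_ (ae_restrict_of_ae this.symm)
    refine Integrable.of_bound (measurable_rayDeriv κ₁ κ₂).aestronglyMeasurable
      (max ‖κ₁‖ ‖κ₂‖) (ae_of_all _ fun x => norm_rayDeriv_le (le_max_left _ _) (le_max_right _ _) x)
  differentiable := ⟨{0}, Set.countable_singleton 0, fun s hs =>
    (hasDerivAt_rayPath κ₁ κ₂ (by simpa using hs.2)).differentiableAt⟩
  mem := fun s hs => by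
    refine (norm_rayPath_le (le_max_left ‖κ₁‖ ‖κ₂‖) (le_max_right _ _) s).trans_lt ?_
    have : |s| ≤ 1 := abs_le.2 hs
    calc _ ≤ max ‖κ₁‖ ‖κ₂‖ * 1 := by gcongr
      _ < r := by simpa using ⟨h₁, h₂⟩

/-- The binomial theorem reduces this to Gamma-type integrals with exponents `a + m > -1`. -/
theorem integrableOn_Ioi_rpow_mul_pow_mul_exp {a ε : ℝ} (ha : -1 < a) (hε : 0 < ε) {μ : ℕ}
    (hμ : 1 ≤ μ) (M : ℕ) : IntegrableOn (fun r : ℝ => r ^ a * (r + 1) ^ M * Real.exp (-ε * r ^ μ))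
      (Set.Ioi 0) := by
  have h : ∀ m : ℕ, IntegrableOn (fun r : ℝ => r ^ (a + m) * Real.exp (-ε * r ^ (μ : ℝ)))
      (Set.Ioi 0) := fun m =>
    integrableOn_rpow_mul_exp_neg_mul_rpow
      (by have : (0 : ℝ) ≤ m := m.cast_nonneg
          linarith) (by exact_mod_cast hμ) hε
  have h2 : IntegrableOn (fun r : ℝ => ∑ m ∈ Finset.range (M + 1),
      (r ^ (a + m) * Real.exp (-ε * r ^ (μ : ℝ))) * (M.choose m : ℝ)) (Set.Ioi 0) :=
    integrable_finsetSum _ fun m _ => (h m).mul_const _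
  refine h2.congr_fun (fun r hr => ?_) measurableSet_Ioi
  have hr : 0 < r := hr
  simp only [add_pow, one_pow, mul_one, Real.rpow_natCast, Finset.mul_sum, Finset.sum_mul,
    Real.rpow_add hr]
  exact Finset.sum_congr rfl fun m _ => by ring

/-- The one-variable factor `exp(-p₀ w^μ) w^a dw` of the integrand along the rays. -/
noncomputable def rayFactor (κ₁ κ₂ p₀ : ℂ) (μ : ℕ) (a : ℝ) (r : ℝ) : ℂ :=
  Complex.exp (-(p₀ * rayPath κ₁ κ₂ r ^ μ)) * rayPath κ₁ κ₂ r ^ (a : ℂ) * rayDeriv κ₁ κ₂ r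

theorem measurable_rayFactor (κ₁ κ₂ p₀ : ℂ) (μ : ℕ) (a : ℝ) :
    Measurable (rayFactor κ₁ κ₂ p₀ μ a) := by
  have h1 := measurable_rayPath κ₁ κ₂
  have h2 := measurable_rayDeriv κ₁ κ₂
  unfold rayFactor
  fun_prop

theorem norm_exp_mul_ray (p₀ κ : ℂ) (μ : ℕ) {r : ℝ} (a : ℝ) (hr : 0 ≤ r) :
    ‖Complex.exp (-(p₀ * ((r : ℂ) * κ) ^ μ)) * ((r : ℂ) * κ) ^ (a : ℂ)‖ =
      ‖κ‖ ^ a * (r ^ a * Real.exp (-(p₀ * κ ^ μ).re * r ^ μ)) := by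
  have h1 : (-(p₀ * ((r : ℂ) * κ) ^ μ)).re = -(p₀ * κ ^ μ).re * r ^ μ := by
    rw [show -(p₀ * ((r : ℂ) * κ) ^ μ) = ((-(r ^ μ) : ℝ) : ℂ) * (p₀ * κ ^ μ) by push_cast; ring,
      Complex.re_ofReal_mul]
    ring
  rw [norm_mul, Complex.norm_exp, h1, Complex.norm_cpow_real, norm_mul, Complex.norm_real,
    Real.norm_of_nonneg hr, Real.mul_rpow hr (norm_nonneg _)]
  ring

theorem integrable_rayFactor_mul {κ₁ κ₂ p₀ : ℂ} {μ : ℕ} (hμ : 1 ≤ μ)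
    (h₁ : 0 < (p₀ * κ₁ ^ μ).re) (h₂ : 0 < (p₀ * κ₂ ^ μ).re) {a : ℝ} (ha : -1 < a) (M : ℕ) :
    Integrable fun r => ‖rayFactor κ₁ κ₂ p₀ μ a r‖ * (|r| + 1) ^ M := by
  rw [← integrableOn_univ, ← Set.Iio_union_Ici (a := (0 : ℝ))]
  refine IntegrableOn.union ?_ ((integrableOn_Ici_iff_integrableOn_Ioi (by simp)).2 ?_)
  · have hi := ((integrableOn_Ioi_rpow_mul_pow_mul_exp ha h₁ hμ M).const_mul
      (‖κ₁‖ ^ a * ‖κ₁‖))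
    have hi' : IntegrableOn (fun r : ℝ => ‖κ₁‖ ^ a * ‖κ₁‖ *
      ((-r) ^ a * (-r + 1) ^ M * Real.exp (-(p₀ * κ₁ ^ μ).re * (-r) ^ μ))) (Set.Iio 0) := by
      rw [← neg_zero] at hi
      exact IntegrableOn.comp_neg_Iio hi
    refine hi'.congr_fun (fun r hr => ?_) measurableSet_Iio
    have hr : r < 0 := hr
    simp only [rayFactor, rayPath, rayDeriv, if_pos hr]
    rw [norm_mul, norm_exp_mul_ray _ _ _ _ (by linarith), abs_of_neg hr, norm_neg]
    ring
  · have hi : IntegrableOn (fun r : ℝ => ‖κ₂‖ ^ a * ‖κ₂‖ *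
        (r ^ a * (r + 1) ^ M * Real.exp (-(p₀ * κ₂ ^ μ).re * r ^ μ))) (Set.Ioi 0) :=
      (integrableOn_Ioi_rpow_mul_pow_mul_exp ha h₂ hμ M).const_mul _
    refine hi.congr_fun (fun r hr => ?_) measurableSet_Ioi
    have hr : 0 < r := hr
    simp only [rayFactor, rayPath, rayDeriv, if_neg hr.not_gt]
    rw [norm_mul, norm_exp_mul_ray _ _ _ _ hr.le, abs_of_pos hr]
    ring

/-- Homogeneity with `c = ‖x‖` compares `h x` with its values on the unit circle. An integer `K ≥ ν`
replaces the real exponent. -/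
theorem exists_growth_of_homogeneous {h : ℂ → ℂ} (hh : Continuous h) {ν : ℝ}
    (hhom : ∀ c : ℂ, 0 < c.re → ∀ x : ℂ, h (c * x) = c ^ (ν : ℂ) * h x) :
    ∃ C : ℝ, 0 ≤ C ∧ ∃ K : ℕ, ∀ x, ‖h x‖ ≤ C * (1 + ‖x‖) ^ K := by
  obtain ⟨C, hC⟩ := (isCompact_closedBall (0 : ℂ) 1).exists_bound_of_continuousOn hh.continuousOn
  obtain ⟨K, hK⟩ := exists_nat_ge ν
  have hC0 : 0 ≤ C := (norm_nonneg _).trans (hC 0 (by simp))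
  refine ⟨C, hC0, K, fun x => ?_⟩
  rcases le_or_gt ‖x‖ 1 with hx | hx
  · refine (hC x (by simpa using hx)).trans (le_mul_of_one_le_right hC0 ?_)
    exact one_le_pow₀ (by linarith [norm_nonneg x])
  · have hx0 : (0 : ℝ) < ‖x‖ := by linarith
    have hxc : (‖x‖ : ℂ) ≠ 0 := by exact_mod_cast hx0.ne'
    have h1 := hhom ‖x‖ (by simpa using hx0) (x / ‖x‖)
    rw [mul_div_cancel₀ _ hxc] at h1
    rw [h1, norm_mul, Complex.norm_cpow_real, Complex.norm_real, norm_norm, mul_comm]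
    have h2 : ‖h (x / ‖x‖)‖ ≤ C := hC _ (by simp [hx0.ne'])
    have h3 : ‖x‖ ^ ν ≤ (1 + ‖x‖) ^ K := by
      rw [← Real.rpow_natCast]
      calc ‖x‖ ^ ν ≤ ‖x‖ ^ (K : ℝ) := Real.rpow_le_rpow_of_exponent_le hx.le hK
        _ ≤ (1 + ‖x‖) ^ (K : ℝ) := by gcongr; linarith
    gcongr

theorem one_add_abs_le_prod {n : ℕ} (s : Fin n → ℝ) (i : Fin n) :
    |s i| + 1 ≤ ∏ j, (|s j| + 1) := by
  rw [← Finset.mul_prod_erase _ _ (Finset.mem_univ i)]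
  refine le_mul_of_one_le_right (by positivity) (Finset.one_le_prod fun j _ => ?_)
  linarith [abs_nonneg (s j)]

theorem one_le_prod_one_add_abs {n : ℕ} (s : Fin n → ℝ) : 1 ≤ ∏ j, (|s j| + 1) :=
  Finset.one_le_prod fun j _ => by linarith [abs_nonneg (s j)]

/-- A product majorant lets polynomial growth be distributed over the one-variable integrals. -/
theorem one_add_norm_le_prod {n : ℕ} (s : Fin n → ℝ) : 1 + ‖s‖ ≤ ∏ j, (|s j| + 1) := by
  have : ‖s‖ ≤ ∏ j, (|s j| + 1) - 1 :=
    (pi_norm_le_iff_of_nonneg (by linarith [one_le_prod_one_add_abs s])).2 fun i => by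
      rw [Real.norm_eq_abs]; linarith [one_add_abs_le_prod s i]
  linarith

theorem exists_norm_vanderProd_rayPath_le (n : ℕ) (κ₁ κ₂ : ℂ) :
    ∃ B : ℝ, 0 ≤ B ∧ ∃ D : ℕ, ∀ s : Fin n → ℝ,
      1 + ‖vanderProd fun j => rayPath κ₁ κ₂ (s j)‖ ≤ B * (∏ j, (|s j| + 1)) ^ D := by
  set κ := max 1 (max ‖κ₁‖ ‖κ₂‖)
  have hκ : 1 ≤ κ := le_max_left _ _
  have h₁ : ‖κ₁‖ ≤ κ := (le_max_left _ _).trans (le_max_right _ _)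
  have h₂ : ‖κ₂‖ ≤ κ := (le_max_right _ _).trans (le_max_right _ _)
  set D := ∑ i : Fin n, (Finset.Ioi i).card
  refine ⟨1 + (2 * κ) ^ D, by positivity, D, fun s => ?_⟩
  set W := ∏ j, (|s j| + 1)
  have hW : 1 ≤ W := one_le_prod_one_add_abs s
  have hΔ : ‖vanderProd fun j => rayPath κ₁ κ₂ (s j)‖ ≤ (2 * κ * W) ^ D := by
    rw [vanderProd, norm_prod, ← Finset.prod_pow_eq_pow_sum]
    refine Finset.prod_le_prod (fun _ _ => norm_nonneg _) fun i _ => ?_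
    rw [norm_prod, ← Finset.prod_const]
    refine Finset.prod_le_prod (fun _ _ => norm_nonneg _) fun j _ => ?_
    have hb : ∀ i, ‖rayPath κ₁ κ₂ (s i)‖ ≤ κ * W := fun i =>
      (norm_rayPath_le h₁ h₂ _).trans (by
        gcongr
        linarith [one_add_abs_le_prod s i])
    linarith [norm_sub_le (rayPath κ₁ κ₂ (s i)) (rayPath κ₁ κ₂ (s j)), hb i, hb j]
  rw [mul_pow] at hΔ
  rw [add_mul, one_mul]
  exact add_le_add (one_le_pow₀ hW) hΔ

/-- The integrand `exp(-p₀ ∑_j w_j^μ) h(Δ(w)) w^(lam-1) dw` along the rays. -/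
noncomputable def rayKernel {n : ℕ} (κ₁ κ₂ p₀ : ℂ) (μ : ℕ) (h : ℂ → ℂ) (lam : Fin n → ℝ)
    (s : Fin n → ℝ) : ℂ :=
  Complex.exp (-(p₀ * ∑ j, rayPath κ₁ κ₂ (s j) ^ μ)) *
    h (vanderProd fun j => rayPath κ₁ κ₂ (s j)) *
      powSubOne lam (fun j => rayPath κ₁ κ₂ (s j)) * ∏ j, rayDeriv κ₁ κ₂ (s j)

theorem rayKernel_eq {n : ℕ} (κ₁ κ₂ p₀ : ℂ) (μ : ℕ) (h : ℂ → ℂ) (lam : Fin n → ℝ)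
    (s : Fin n → ℝ) : rayKernel κ₁ κ₂ p₀ μ h lam s =
      h (vanderProd fun j => rayPath κ₁ κ₂ (s j)) *
        ∏ j, rayFactor κ₁ κ₂ p₀ μ (lam j - 1) (s j) := by
  simp only [rayKernel, rayFactor, powSubOne, Finset.prod_mul_distrib, Finset.mul_sum,
    ← Finset.sum_neg_distrib, Complex.exp_sum]
  ring

theorem measurable_vanderProd_rayPath (n : ℕ) (κ₁ κ₂ : ℂ) :
    Measurable fun s : Fin n → ℝ => vanderProd fun j => rayPath κ₁ κ₂ (s j) := by
  have h1 := measurable_rayPath κ₁ κ₂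
  unfold vanderProd
  fun_prop

theorem measurable_rayKernel {n : ℕ} (κ₁ κ₂ p₀ : ℂ) (μ : ℕ) {h : ℂ → ℂ} (hh : Continuous h)
    (lam : Fin n → ℝ) : Measurable (rayKernel κ₁ κ₂ p₀ μ h lam) := by
  have h1 := fun j => measurable_rayFactor κ₁ κ₂ p₀ μ (lam j - 1)
  have h2 := measurable_vanderProd_rayPath n κ₁ κ₂
  have h3 := hh.measurable
  have : rayKernel κ₁ κ₂ p₀ μ h lam = fun s => h (vanderProd fun j => rayPath κ₁ κ₂ (s j)) *
        ∏ j, rayFactor κ₁ κ₂ p₀ μ (lam j - 1) (s j) := funext fun s => rayKernel_eq ..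
  rw [this]
  fun_prop

/-- The growth of `h ∘ Δ` and of `f` is absorbed into powers of `|s j| + 1`, leaving a product of
integrable one-variable functions as majorant. -/
theorem integrable_rayKernel_mul {n : ℕ} {κ₁ κ₂ p₀ : ℂ} {μ : ℕ} (hμ : 1 ≤ μ)
    (h₁ : 0 < (p₀ * κ₁ ^ μ).re) (h₂ : 0 < (p₀ * κ₂ ^ μ).re) {h : ℂ → ℂ} (hh : Continuous h)
    {ν : ℝ} (hhom : ∀ c : ℂ, 0 < c.re → ∀ x : ℂ, h (c * x) = c ^ (ν : ℂ) * h x)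
    {lam : Fin n → ℝ} (hlam : ∀ j, 0 < lam j) {f : (Fin n → ℝ) → ℂ}
    (hf : AEStronglyMeasurable f) {C : ℝ} {M : ℕ} (hb : ∀ s, ‖f s‖ ≤ C * (1 + ‖s‖) ^ M) :
    Integrable fun s => rayKernel κ₁ κ₂ p₀ μ h lam s * f s := by
  obtain ⟨A, hA, K, hK⟩ := exists_growth_of_homogeneous hh hhom
  obtain ⟨B, hB, D, hD⟩ := exists_norm_vanderProd_rayPath_le n κ₁ κ₂
  have hC : 0 ≤ C := by
    have := (norm_nonneg _).trans (hb 0)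
    simpa using this
  have hi : Integrable fun s : Fin n → ℝ => ∏ j, ‖rayFactor κ₁ κ₂ p₀ μ (lam j - 1) (s j)‖ *
      (|s j| + 1) ^ (D * K + M) :=
    Integrable.fintype_prod_dep fun j =>
      integrable_rayFactor_mul hμ h₁ h₂ (a := lam j - 1) (by linarith [hlam j]) (D * K + M)
  refine (hi.const_mul (A * B ^ K * C)).mono'
    ((measurable_rayKernel κ₁ κ₂ p₀ μ hh lam).aestronglyMeasurable.mul hf)
    (ae_of_all _ fun s => ?_)
  set W := ∏ j, (|s j| + 1) with hW
  have hW1 : 1 ≤ W := one_le_prod_one_add_abs s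
  have e1 : ‖h (vanderProd fun j => rayPath κ₁ κ₂ (s j))‖ ≤ A * (B * W ^ D) ^ K :=
    (hK _).trans (by gcongr; exact hD s)
  have e2 : ‖f s‖ ≤ C * W ^ M := (hb s).trans (by gcongr; exact one_add_norm_le_prod s)
  rw [norm_mul, rayKernel_eq, norm_mul, norm_prod, Finset.prod_mul_distrib, Finset.prod_pow, ← hW]
  set R := ∏ j, ‖rayFactor κ₁ κ₂ p₀ μ (lam j - 1) (s j)‖
  have hR : 0 ≤ R := Finset.prod_nonneg fun _ _ => norm_nonneg _
  calc _ ≤ A * (B * W ^ D) ^ K * R * (C * W ^ M) := by gcongr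
    _ = A * B ^ K * C * (R * W ^ (D * K + M)) := by
      rw [mul_pow, ← pow_mul, pow_add]; ring

/-! ### Scaling along the rays -/

theorem sum_card_Ioi (n : ℕ) :
    ((∑ i : Fin n, (Finset.Ioi i).card : ℕ) : ℝ) = n * ((n : ℝ) - 1) / 2 := by
  have h1 : ∑ i : Fin n, (Finset.Ioi i).card = ∑ i ∈ Finset.range n, i := by
    simp only [Fin.card_Ioi]
    rw [Fin.sum_univ_eq_sum_range (fun i => n - 1 - i) n, Finset.sum_range_reflect (fun i => i)]
  have h2 := Finset.sum_range_id_mul_two n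
  rw [h1]
  rcases Nat.eq_zero_or_pos n with rfl | hn
  · simp
  have h3 : ((∑ i ∈ Finset.range n, i : ℕ) : ℝ) * 2 = n * ((n : ℝ) - 1) := by
    rw [← Nat.cast_pred hn]
    exact_mod_cast h2
  linarith

theorem vanderProd_smul {n : ℕ} (c : ℂ) (w : Fin n → ℂ) :
    vanderProd (fun j => c * w j) = c ^ (∑ i : Fin n, (Finset.Ioi i).card) * vanderProd w := by
  simp only [vanderProd, ← mul_sub, Finset.prod_mul_distrib, Finset.prod_const,
    Finset.prod_pow_eq_pow_sum]

theorem ofReal_mul_cpow_ofReal {c : ℝ} (hc : 0 < c) (z : ℂ) (a : ℝ) :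
    (c * z : ℂ) ^ (a : ℂ) = ((c ^ a : ℝ) : ℂ) * z ^ (a : ℂ) := by
  have hc' : (c : ℂ) ≠ 0 := by exact_mod_cast hc.ne'
  rcases eq_or_ne z 0 with rfl | hz
  · rcases eq_or_ne a 0 with rfl | ha
    · simp
    · have : (a : ℂ) ≠ 0 := by exact_mod_cast ha
      simp [Complex.zero_cpow this]
  · rw [Complex.ofReal_cpow hc.le, Complex.cpow_def_of_ne_zero (mul_ne_zero hc' hz),
      Complex.cpow_def_of_ne_zero hz, Complex.cpow_def_of_ne_zero hc', ← Complex.exp_add,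
      Complex.log_ofReal_mul hc hz, Complex.ofReal_log hc.le, add_mul]

theorem powSubOne_smul {n : ℕ} (lam : Fin n → ℝ) {c : ℝ} (hc : 0 < c) (w : Fin n → ℂ) :
    powSubOne lam (fun j => c * w j) = ((c ^ (∑ j, (lam j - 1)) : ℝ) : ℂ) * powSubOne lam w := by
  simp only [powSubOne, ofReal_mul_cpow_ofReal hc, Finset.prod_mul_distrib]
  rw [← Complex.ofReal_prod, Real.rpow_sum_of_pos hc]

/-- The relation `N c^μ = 1` removes `N` from the exponential. The power of `c` comes from
homogeneity of `h ∘ Δ` and of `w^(lam-1)`; the ray directions are unchanged. -/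
theorem rayKernel_smul {n : ℕ} (κ₁ κ₂ p₀ : ℂ) (μ : ℕ) {h : ℂ → ℂ} {ν : ℝ}
    (hhom : ∀ c : ℂ, 0 < c.re → ∀ x : ℂ, h (c * x) = c ^ (ν : ℂ) * h x)
    (lam : Fin n → ℝ) {N c : ℝ} (hc : 0 < c) (hN : N * c ^ μ = 1) (s : Fin n → ℝ) :
    rayKernel κ₁ κ₂ (N * p₀) μ h lam (c • s) =
      ((c ^ (ν * (n * ((n : ℝ) - 1) / 2) + ∑ j, (lam j - 1)) : ℝ) : ℂ) *
        rayKernel κ₁ κ₂ p₀ μ h lam s := by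
  have hcD : 0 < c ^ (∑ i : Fin n, (Finset.Ioi i).card) := by positivity
  have e1 : (N * p₀ * ∑ j, (c * rayPath κ₁ κ₂ (s j)) ^ μ : ℂ) =
      p₀ * ∑ j, rayPath κ₁ κ₂ (s j) ^ μ := by
    have hN' : (N * c ^ μ : ℂ) = 1 := by exact_mod_cast hN
    simp only [mul_pow, ← Finset.mul_sum]
    linear_combination (p₀ * ∑ j, rayPath κ₁ κ₂ (s j) ^ μ) * hN'
  have e2 : h (vanderProd fun j => c * rayPath κ₁ κ₂ (s j)) =
      ((c ^ (ν * (n * ((n : ℝ) - 1) / 2)) : ℝ) : ℂ) *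
        h (vanderProd fun j => rayPath κ₁ κ₂ (s j)) := by
    rw [vanderProd_smul, ← Complex.ofReal_pow, hhom _ (by rwa [Complex.ofReal_re]),
      ← Complex.ofReal_cpow hcD.le, ← Real.rpow_natCast, ← Real.rpow_mul hc.le, sum_card_Ioi,
      mul_comm ν]
  simp only [rayKernel, Pi.smul_apply, smul_eq_mul, rayPath_mul _ _ hc, rayDeriv_mul _ _ hc]
  rw [e1, e2, powSubOne_smul lam hc, Real.rpow_add hc]
  push_cast
  ring

theorem integral_of_homogeneous {n : ℕ} {E : Type*} [NormedAddCommGroup E] [NormedSpace ℝ E]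
    {f g : (Fin n → ℝ) → E} {c e : ℝ} (hc : 0 < c) (hfg : ∀ s, f (c • s) = (c ^ e : ℝ) • g s) :
    ∫ s, f s = (c ^ (e + n) : ℝ) • ∫ s, g s := by
  have h1 := Measure.integral_comp_smul_of_nonneg (volume : Measure (Fin n → ℝ)) f c (hR := hc.le)
  simp only [hfg, integral_smul, Module.finrank_fin_fun] at h1
  rw [Real.rpow_add hc, Real.rpow_natCast, mul_comm, mul_smul, h1,
    smul_inv_smul₀ (pow_ne_zero _ hc.ne')]

/-- The final `n` is the Jacobian of the dilation and cancels the `-n` in `∑ (lam j - 1)`. -/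
theorem expansionExponent_rpow {n : ℕ} (ν : ℝ) (lam : Fin n → ℝ) {μ : ℕ} (k : ℕ)
    {N : ℝ} (hN : 0 < N) :
    (N ^ (-(1 / μ : ℝ))) ^ (ν * (n * ((n : ℝ) - 1) / 2) + ∑ j, (lam j - 1) + k + n) =
      N ^ (-expansionExponent ν lam μ k) := by
  rw [← Real.rpow_mul hN.le]
  congr 1
  rw [expansionExponent, Finset.sum_sub_distrib]
  simp
  ring

theorem rpow_neg_inv_pow {μ : ℕ} (hμ : 1 ≤ μ) {N : ℝ} (hN : 0 < N) :
    N * (N ^ (-(1 / μ : ℝ))) ^ μ = 1 := by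
  have : (μ : ℝ) ≠ 0 := by exact_mod_cast (by omega : μ ≠ 0)
  rw [← Real.rpow_natCast, ← Real.rpow_mul hN.le]
  rw [show -(1 / (μ : ℝ)) * μ = -1 by field_simp, Real.rpow_neg_one, mul_inv_cancel₀ hN.ne']

theorem sum_eq_of_isHomogeneous {n k : ℕ} {H : MvPolynomial (Fin n) ℂ} (hH : H.IsHomogeneous k)
    {d : Fin n →₀ ℕ} (hd : d ∈ H.support) : ∑ i, d i = k := by
  have := hH (MvPolynomial.mem_support_iff.1 hd)
  rw [← this, Finsupp.weight_apply, Finsupp.sum_fintype _ _ (by simp)]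
  simp

theorem eval_smul_of_isHomogeneous {n k : ℕ} {H : MvPolynomial (Fin n) ℂ}
    (hH : H.IsHomogeneous k) (c : ℂ) (w : Fin n → ℂ) :
    MvPolynomial.eval (c • w) H = c ^ k * MvPolynomial.eval w H := by
  rw [MvPolynomial.eval_eq', MvPolynomial.eval_eq', Finset.mul_sum]
  refine Finset.sum_congr rfl fun d hd => ?_
  simp only [Pi.smul_apply, smul_eq_mul, mul_pow, Finset.prod_mul_distrib,
    Finset.prod_pow_eq_pow_sum, sum_eq_of_isHomogeneous hH hd]
  ring

theorem exists_norm_eval_le_of_isHomogeneous {n k : ℕ} {H : MvPolynomial (Fin n) ℂ}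
    (hH : H.IsHomogeneous k) :
    ∃ C : ℝ, 0 ≤ C ∧ ∀ w : Fin n → ℂ, ‖MvPolynomial.eval w H‖ ≤ C * ‖w‖ ^ k := by
  refine ⟨∑ d ∈ H.support, ‖H.coeff d‖, Finset.sum_nonneg fun _ _ => norm_nonneg _, fun w => ?_⟩
  rw [MvPolynomial.eval_eq', Finset.sum_mul]
  refine norm_sum_le_of_le _ fun d hd => ?_
  rw [norm_mul, norm_prod]
  gcongr
  rw [← sum_eq_of_isHomogeneous hH hd, ← Finset.prod_pow_eq_pow_sum]
  refine Finset.prod_le_prod (fun _ _ => norm_nonneg _) fun i _ => ?_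
  rw [norm_pow]
  gcongr
  exact norm_le_pi_norm w i

theorem integral_rayKernel_mul_homogeneous {n : ℕ} (κ₁ κ₂ p₀ : ℂ) {μ : ℕ} (hμ : 1 ≤ μ)
    {h : ℂ → ℂ} {ν : ℝ} (hhom : ∀ c : ℂ, 0 < c.re → ∀ x : ℂ, h (c * x) = c ^ (ν : ℂ) * h x)
    (lam : Fin n → ℝ) {k : ℕ} {H : MvPolynomial (Fin n) ℂ} (hH : H.IsHomogeneous k)
    {N : ℝ} (hN : 0 < N) :
    ∫ s, rayKernel κ₁ κ₂ (N * p₀) μ h lam s *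
        MvPolynomial.eval (fun j => rayPath κ₁ κ₂ (s j)) H =
      (∫ s, rayKernel κ₁ κ₂ p₀ μ h lam s *
        MvPolynomial.eval (fun j => rayPath κ₁ κ₂ (s j)) H) *
          ((N ^ (-expansionExponent ν lam μ k) : ℝ) : ℂ) := by
  have hc : 0 < N ^ (-(1 / μ : ℝ)) := by positivity
  rw [integral_of_homogeneous (e := ν * (n * ((n : ℝ) - 1) / 2) + ∑ j, (lam j - 1) + k) hc
    (g := fun s => rayKernel κ₁ κ₂ p₀ μ h lam s *
        MvPolynomial.eval (fun j => rayPath κ₁ κ₂ (s j)) H), expansionExponent_rpow _ _ _ hN,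
    Complex.real_smul, mul_comm]
  intro s
  rw [rayKernel_smul κ₁ κ₂ p₀ μ hhom lam hc (rpow_neg_inv_pow hμ hN)]
  simp only [Pi.smul_apply, smul_eq_mul, rayPath_mul _ _ hc]
  rw [show (fun j => ((N ^ (-(1 / μ : ℝ)) : ℝ) : ℂ) * rayPath κ₁ κ₂ (s j)) =
    ((N ^ (-(1 / μ : ℝ)) : ℝ) : ℂ) • fun j => rayPath κ₁ κ₂ (s j) from rfl, eval_smul_of_isHomogeneous hH,
    Complex.real_smul, Real.rpow_add hc _ (k : ℝ), Real.rpow_natCast]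
  push_cast
  ring

theorem integral_norm_rayKernel_mul_pow {n : ℕ} (κ₁ κ₂ p₀ : ℂ) {μ : ℕ} (hμ : 1 ≤ μ)
    {h : ℂ → ℂ} {ν : ℝ} (hhom : ∀ c : ℂ, 0 < c.re → ∀ x : ℂ, h (c * x) = c ^ (ν : ℂ) * h x)
    (lam : Fin n → ℝ) (k : ℕ) {N : ℝ} (hN : 0 < N) :
    ∫ s, ‖rayKernel κ₁ κ₂ (N * p₀) μ h lam s‖ * ‖s‖ ^ k =
      (∫ s, ‖rayKernel κ₁ κ₂ p₀ μ h lam s‖ * ‖s‖ ^ k) *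
          N ^ (-expansionExponent ν lam μ k) := by
  have hc : 0 < N ^ (-(1 / μ : ℝ)) := by positivity
  rw [integral_of_homogeneous (e := ν * (n * ((n : ℝ) - 1) / 2) + ∑ j, (lam j - 1) + k) hc
    (g := fun s => ‖rayKernel κ₁ κ₂ p₀ μ h lam s‖ * ‖s‖ ^ k), expansionExponent_rpow _ _ _ hN,
    smul_eq_mul, mul_comm]
  intro s
  rw [rayKernel_smul κ₁ κ₂ p₀ μ hhom lam hc (rpow_neg_inv_pow hμ hN), norm_mul, norm_smul,
    Complex.norm_real, Real.norm_of_nonneg hc.le, Real.norm_of_nonneg (by positivity), smul_eq_mul,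
    Real.rpow_add hc _ (k : ℝ), Real.rpow_natCast]
  ring

theorem coeffIntegrand_rayPath_ae {n : ℕ} (κ₁ κ₂ p₀ : ℂ) (μ : ℕ) (h : ℂ → ℂ) (lam : Fin n → ℝ)
    (a : MvPolynomial (Fin n) ℂ) :
    contourIntegrand (rayPath κ₁ κ₂) (coeffIntegrand p₀ μ h lam a) =ᵐ[volume] fun s =>
      rayKernel κ₁ κ₂ p₀ μ h lam s * MvPolynomial.eval (fun j => rayPath κ₁ κ₂ (s j)) a := by
  filter_upwards [contourIntegrand_rayPath_ae κ₁ κ₂ (coeffIntegrand p₀ μ h lam a)] with s hs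
  rw [hs, coeffIntegrand, rayKernel]
  ring

theorem norm_rayPath_pi_le {n : ℕ} {κ₁ κ₂ : ℂ} {κ : ℝ} (h₁ : ‖κ₁‖ ≤ κ) (h₂ : ‖κ₂‖ ≤ κ)
    (s : Fin n → ℝ) : ‖fun j => rayPath κ₁ κ₂ (s j)‖ ≤ κ * ‖s‖ := by
  have hκ : 0 ≤ κ := (norm_nonneg _).trans h₁
  refine (pi_norm_le_iff_of_nonneg (by positivity)).2 fun j => ?_
  refine (norm_rayPath_le h₁ h₂ _).trans ?_
  gcongr
  exact norm_le_pi_norm s j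

theorem one_lt_norm_of_notMem_paramBox {n : ℕ} {s : Fin n → ℝ} (hs : s ∉ paramBox n (-1) 1) :
    1 < ‖s‖ := by
  by_contra hlt
  exact hs fun j _ => abs_le.1 ((norm_le_pi_norm s j).trans (not_lt.1 hlt))

theorem continuous_eval_rayPath {n : ℕ} (κ₁ κ₂ : ℂ) (a : MvPolynomial (Fin n) ℂ) :
    Continuous fun s : Fin n → ℝ => MvPolynomial.eval (fun j => rayPath κ₁ κ₂ (s j)) a :=
  (continuous_eval_mvPolynomial a).comp
    (continuous_pi fun j => (continuous_rayPath κ₁ κ₂).comp (continuous_apply j))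

theorem integrable_rayKernel_mul_eval {n : ℕ} {κ₁ κ₂ p₀ : ℂ} {μ : ℕ} (hμ : 1 ≤ μ)
    (h₁ : 0 < (p₀ * κ₁ ^ μ).re) (h₂ : 0 < (p₀ * κ₂ ^ μ).re) {h : ℂ → ℂ} (hh : Continuous h)
    {ν : ℝ} (hhom : ∀ c : ℂ, 0 < c.re → ∀ x : ℂ, h (c * x) = c ^ (ν : ℂ) * h x)
    {lam : Fin n → ℝ} (hlam : ∀ j, 0 < lam j) {k : ℕ} {a : MvPolynomial (Fin n) ℂ}
    (ha : a.IsHomogeneous k) :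
    Integrable fun s => rayKernel κ₁ κ₂ p₀ μ h lam s *
      MvPolynomial.eval (fun j => rayPath κ₁ κ₂ (s j)) a := by
  obtain ⟨C, hC, hb⟩ := exists_norm_eval_le_of_isHomogeneous ha
  set κ := max ‖κ₁‖ ‖κ₂‖
  have hκ : 0 ≤ κ := (norm_nonneg _).trans (le_max_left ‖κ₁‖ ‖κ₂‖)
  refine integrable_rayKernel_mul hμ h₁ h₂ hh hhom hlam (C := C * κ ^ k) (M := k)
    (continuous_eval_rayPath κ₁ κ₂ a).aestronglyMeasurable fun s => (hb _).trans ?_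
  rw [mul_assoc, ← mul_pow]
  gcongr
  refine (norm_rayPath_pi_le (le_max_left _ _) (le_max_right _ _) s).trans ?_
  gcongr
  linarith

/-! ### Remainder estimate and expansion along the rays -/

/-- The truncated integrand is `O(‖s‖^m)` on the whole parameter space. -/
theorem exists_remainder_bound {n : ℕ} {F : (Fin n → ℂ) → ℂ}
    {P : FormalMultilinearSeries ℂ (Fin n → ℂ) ℂ} {R : ENNReal}
    (hF : HasFPowerSeriesOnBall F P 0 R) {r : NNReal} (hr0 : 0 < r) (hr : (r : ENNReal) < R)
    {κ₁ κ₂ : ℂ} (h₁ : ‖κ₁‖ < r) (h₂ : ‖κ₂‖ < r) (m : ℕ) :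
    ∃ C : ℝ, 0 ≤ C ∧ ∀ s : Fin n → ℝ,
      ‖(paramBox n (-1) 1).indicator (fun s => F fun j => rayPath κ₁ κ₂ (s j)) s -
        ∑ k ∈ Finset.range m, MvPolynomial.eval (fun j => rayPath κ₁ κ₂ (s j)) (seriesTerm P k)‖
        ≤ C * ‖s‖ ^ m := by
  obtain ⟨a, ha, C, hC, hb⟩ := hF.uniform_geometric_approx' hr
  choose D hD0 hD using fun k => exists_norm_eval_le_of_isHomogeneous (seriesTerm_isHomogeneous P k)
  set κ : ℝ := max ‖κ₁‖ ‖κ₂‖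
  have hκ : 0 ≤ κ := (norm_nonneg _).trans (le_max_left ‖κ₁‖ ‖κ₂‖)
  have hr' : (0 : ℝ) < r := hr0
  have ha0 := ha.1.le
  have hDsum : 0 ≤ ∑ k ∈ Finset.range m, D k * κ ^ k :=
    Finset.sum_nonneg fun k _ => mul_nonneg (hD0 k) (pow_nonneg hκ k)
  have hA : 0 ≤ C * (a * (κ / r)) ^ m := by positivity
  refine ⟨C * (a * (κ / r)) ^ m + ∑ k ∈ Finset.range m, D k * κ ^ k, by positivity, fun s => ?_⟩
  have hL : ‖fun j => rayPath κ₁ κ₂ (s j)‖ ≤ κ * ‖s‖ :=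
    norm_rayPath_pi_le (le_max_left _ _) (le_max_right _ _) s
  rw [add_mul]
  -- Inside the box this is the Taylor remainder of `F`. Outside only the subtracted terms remain,
  -- and `‖s‖ > 1` raises their powers to `‖s‖^m`, so no separate tail estimate is needed.
  by_cases hs : s ∈ paramBox n (-1) 1
  · refine le_trans ?_ (le_add_of_nonneg_right (by positivity))
    rw [Set.indicator_of_mem hs, ← map_sum, eval_sum_seriesTerm]
    have := hb _ ((isArcInDisk_rayPath h₁ h₂).norm_comp_lt hr' hs) m
    rw [zero_add] at this
    refine this.trans ?_
    rw [mul_assoc C, ← mul_pow, mul_assoc a, div_mul_eq_mul_div]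
    gcongr
  · refine le_trans ?_ (le_add_of_nonneg_left (by positivity))
    have hs1 := (one_lt_norm_of_notMem_paramBox hs).le
    rw [Set.indicator_of_notMem hs, zero_sub, norm_neg, Finset.sum_mul]
    refine norm_sum_le_of_le _ fun k hk => (hD k _).trans ?_
    have hk' : k ≤ m := (Finset.mem_range.1 hk).le
    calc D k * ‖fun j => rayPath κ₁ κ₂ (s j)‖ ^ k ≤ D k * (κ * ‖s‖) ^ k := by
          gcongr
          exact hD0 k
      _ = D k * κ ^ k * ‖s‖ ^ k := by rw [mul_pow, mul_assoc]
      _ ≤ D k * κ ^ k * ‖s‖ ^ m := by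
          have := hD0 k
          gcongr

/-- Watson-type expansion of the integral along the two truncated rays. -/
theorem isBigO_ray_expansion {n : ℕ} {F : (Fin n → ℂ) → ℂ}
    {P : FormalMultilinearSeries ℂ (Fin n → ℂ) ℂ} {R : ENNReal}
    (hF : HasFPowerSeriesOnBall F P 0 R) {r : NNReal} (hr0 : 0 < r) (hr : (r : ENNReal) < R)
    {κ₁ κ₂ : ℂ} (hκ₁ : ‖κ₁‖ < r) (hκ₂ : ‖κ₂‖ < r) {p₀ : ℂ} {μ : ℕ} (hμ : 1 ≤ μ)
    (h₁ : 0 < (p₀ * κ₁ ^ μ).re) (h₂ : 0 < (p₀ * κ₂ ^ μ).re) {h : ℂ → ℂ} (hh : Continuous h)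
    {ν : ℝ} (hhom : ∀ c : ℂ, 0 < c.re → ∀ x : ℂ, h (c * x) = c ^ (ν : ℂ) * h x)
    {lam : Fin n → ℝ} (hlam : ∀ j, 0 < lam j) (m : ℕ) :
    (fun N : ℝ => (∫ s in paramBox n (-1) 1, rayKernel κ₁ κ₂ (N * p₀) μ h lam s *
        F fun j => rayPath κ₁ κ₂ (s j)) -
      ∑ k ∈ Finset.range m, (∫ s, rayKernel κ₁ κ₂ p₀ μ h lam s *
        MvPolynomial.eval (fun j => rayPath κ₁ κ₂ (s j)) (seriesTerm P k)) *
          ((N ^ (-expansionExponent ν lam μ k) : ℝ) : ℂ))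
      =O[atTop] fun N : ℝ => N ^ (-expansionExponent ν lam μ m) := by
  obtain ⟨C, hC, hb⟩ := exists_remainder_bound hF hr0 hr hκ₁ hκ₂ m
  obtain ⟨B, hB, hFb⟩ := (PolyApprox.of_hasFPowerSeriesOnBall hF hr).exists_bound
  have hr' : (0 : ℝ) < r := hr0
  have harc := isArcInDisk_rayPath hκ₁ hκ₂
  -- The constant is the integral of the remainder bound at `N = 1`; dilation supplies the
  -- dependence on `N`.
  refine IsBigO.of_bound (C * ∫ s, ‖rayKernel κ₁ κ₂ p₀ μ h lam s‖ * ‖s‖ ^ m) ?_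
  filter_upwards [eventually_gt_atTop 0] with N hN
  have hNre : ∀ z : ℂ, 0 < (p₀ * z).re → 0 < (N * p₀ * z).re := fun z hz => by
    rw [mul_assoc, Complex.re_ofReal_mul]; positivity
  have h₁N := hNre _ h₁
  have h₂N := hNre _ h₂
  set f₀ : (Fin n → ℝ) → ℂ :=
    (paramBox n (-1) 1).indicator (fun s => F fun j => rayPath κ₁ κ₂ (s j)) with hf₀
  have hm : AEStronglyMeasurable f₀ := by
    refine (aestronglyMeasurable_indicator_iff (measurableSet_paramBox n _ _)).2 ?_
    refine ContinuousOn.aestronglyMeasurable ?_ (measurableSet_paramBox n _ _)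
    exact (PolyApprox.of_hasFPowerSeriesOnBall hF hr).continuousOn.comp
      (continuous_pi fun j => (continuous_rayPath κ₁ κ₂).comp (continuous_apply j)).continuousOn
      fun s hs => harc.norm_comp_lt hr' hs
  have hi : Integrable fun s => rayKernel κ₁ κ₂ (N * p₀) μ h lam s * f₀ s := by
    refine integrable_rayKernel_mul hμ h₁N h₂N hh hhom hlam (C := B) (M := 0) hm fun s => ?_
    rw [pow_zero, mul_one, hf₀]
    by_cases hs : s ∈ paramBox n (-1) 1
    · rw [Set.indicator_of_mem hs]
      exact hFb _ (harc.norm_comp_lt hr' hs)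
    · rw [Set.indicator_of_notMem hs, norm_zero]
      exact hB.le
  have hik : ∀ k, Integrable fun s => rayKernel κ₁ κ₂ (N * p₀) μ h lam s *
      MvPolynomial.eval (fun j => rayPath κ₁ κ₂ (s j)) (seriesTerm P k) := fun k =>
    integrable_rayKernel_mul_eval hμ h₁N h₂N hh hhom hlam (seriesTerm_isHomogeneous P k)
  have hbox : ∫ s in paramBox n (-1) 1, rayKernel κ₁ κ₂ (N * p₀) μ h lam s *
      F (fun j => rayPath κ₁ κ₂ (s j)) = ∫ s, rayKernel κ₁ κ₂ (N * p₀) μ h lam s * f₀ s := by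
    rw [← integral_indicator (measurableSet_paramBox n _ _)]
    refine integral_congr_ae (ae_of_all _ fun s => ?_)
    by_cases hs : s ∈ paramBox n (-1) 1 <;> simp [hf₀, hs]
  have hsum : ∀ k, (∫ s, rayKernel κ₁ κ₂ p₀ μ h lam s *
        MvPolynomial.eval (fun j => rayPath κ₁ κ₂ (s j)) (seriesTerm P k)) *
          ((N ^ (-expansionExponent ν lam μ k) : ℝ) : ℂ) =
      ∫ s, rayKernel κ₁ κ₂ (N * p₀) μ h lam s *
        MvPolynomial.eval (fun j => rayPath κ₁ κ₂ (s j)) (seriesTerm P k) := fun k =>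
    (integral_rayKernel_mul_homogeneous κ₁ κ₂ p₀ hμ hhom lam
      (seriesTerm_isHomogeneous P k) hN).symm
  rw [hbox, Finset.sum_congr rfl fun k _ => hsum k, ← integral_finsetSum _ fun k _ => hik k,
    ← integral_sub hi (integrable_finsetSum _ fun k _ => hik k)]
  have hnorm : Integrable fun s => ‖rayKernel κ₁ κ₂ (N * p₀) μ h lam s‖ * ‖s‖ ^ m := by
    have := (integrable_rayKernel_mul hμ h₁N h₂N hh hhom hlam (f := fun s => ((‖s‖ ^ m : ℝ) : ℂ))
      (C := 1) (M := m) (by fun_prop) fun s => by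
        rw [Complex.norm_real, norm_pow, norm_norm, one_mul]
        gcongr
        linarith).norm
    simpa using this
  rw [Real.norm_of_nonneg (by positivity), mul_assoc,
    ← integral_norm_rayKernel_mul_pow κ₁ κ₂ p₀ hμ hhom lam m hN, ← integral_const_mul]
  refine norm_integral_le_of_norm_le (hnorm.const_mul C) (ae_of_all _ fun s => ?_)
  rw [← Finset.mul_sum, ← mul_sub, norm_mul, mul_left_comm]
  gcongr
  exact hb s

/-! ### Piecewise `C¹` paths and their images -/

theorem exists_disjoint_punctured_nhds {E : Set ℝ} (hE : ∀ c d : ℝ, (E ∩ Set.Icc c d).Finite)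
    (x : ℝ) : ∃ ε > 0, Disjoint E (Set.Ioo (x - ε) x) ∧ Disjoint E (Set.Ioo x (x + ε)) := by
  have hfin : ((E ∩ Set.Icc (x - 1) (x + 1)) \ {x}).Finite := (hE _ _).subset Set.sdiff_subset
  obtain ⟨ε, hε, hb⟩ := Metric.mem_nhds_iff.1 (hfin.isClosed.isOpen_compl.mem_nhds
    (fun h => h.2 rfl : x ∈ ((E ∩ Set.Icc (x - 1) (x + 1)) \ {x})ᶜ))
  have key : ∀ y ∈ E, y ≠ x → x - min ε 1 < y → y < x + min ε 1 → False := by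
    intro y hy hne h1 h2
    have hmin1 := min_le_left ε 1
    have hmin2 := min_le_right ε 1
    refine hb (show y ∈ Metric.ball x ε from ?_) ⟨⟨hy, by linarith, by linarith⟩, hne⟩
    rw [Real.ball_eq_Ioo]
    exact ⟨by linarith, by linarith⟩
  have hm : 0 < min ε 1 := lt_min hε one_pos
  refine ⟨min ε 1, hm, Set.disjoint_left.2 fun y hy h => ?_, Set.disjoint_left.2 fun y hy h => ?_⟩
  · exact key y hy h.2.ne h.1 (by linarith [h.2])
  · exact key y hy h.1.ne' (by linarith [h.1]) h.2

theorem integrableOn_deriv_of_contDiffOn {γ : ℝ → ℂ} {c d : ℝ} (hcd : c < d)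
    (h : ContDiffOn ℝ 1 γ (Set.Icc c d)) : IntegrableOn (deriv γ) (Set.Icc c d) := by
  have h1 : IntegrableOn (derivWithin γ (Set.Icc c d)) (Set.Icc c d) :=
    (h.continuousOn_derivWithin (uniqueDiffOn_Icc hcd) le_rfl).integrableOn_compact isCompact_Icc
  rw [integrableOn_Icc_iff_integrableOn_Ioo] at h1 ⊢
  exact h1.congr_fun (fun x hx => derivWithin_of_mem_nhds (Icc_mem_nhds hx.1 hx.2))
    measurableSet_Ioo

/-- Every point has one-sided closed intervals on which the path is `C¹` up to the ends, so the
derivative is locally integrable. -/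
theorem PiecewiseC1.integrableOn_deriv {γ : ℝ → ℂ} (hγ : PiecewiseC1 γ) (a b : ℝ) :
    IntegrableOn (deriv γ) (Set.Icc a b) := by
  obtain ⟨-, E, hE, hC⟩ := hγ
  have : LocallyIntegrable (deriv γ) := fun x => by
    obtain ⟨ε, hε, h1, h2⟩ := exists_disjoint_punctured_nhds hE x
    refine ⟨Set.Icc (x - ε) (x + ε), Icc_mem_nhds (by linarith) (by linarith), ?_⟩
    rw [← Set.Icc_union_Icc_eq_Icc (b := x) (by linarith) (by linarith)]
    exact (integrableOn_deriv_of_contDiffOn (by linarith) (hC _ _ (by linarith) h1)).union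
      (integrableOn_deriv_of_contDiffOn (by linarith) (hC _ _ (by linarith) h2))
  exact this.integrableOn_isCompact isCompact_Icc

theorem PiecewiseC1.exists_differentiableAt {γ : ℝ → ℂ} (hγ : PiecewiseC1 γ) :
    ∃ E : Set ℝ, E.Countable ∧ ∀ s ∉ E, DifferentiableAt ℝ γ s := by
  obtain ⟨-, E, hE, hC⟩ := hγ
  refine ⟨E, ?_, fun s hs => ?_⟩
  · have : E = ⋃ k : ℕ, E ∩ Set.Icc (-(k : ℝ)) k := by
      ext x
      obtain ⟨k, hk⟩ := exists_nat_ge |x|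
      exact ⟨fun hx => Set.mem_iUnion.2 ⟨k, hx, abs_le.1 hk⟩,
        fun hx => (Set.mem_iUnion.1 hx).choose_spec.1⟩
    rw [this]
    exact Set.countable_iUnion fun k => (hE _ _).countable
  · obtain ⟨ε, hε, h1, h2⟩ := exists_disjoint_punctured_nhds hE s
    have hdisj : Disjoint E (Set.Ioo (s - ε) (s + ε)) := by
      refine Set.disjoint_left.2 fun y hy h => ?_
      rcases lt_trichotomy y s with hlt | rfl | hgt
      · exact Set.disjoint_left.1 h1 hy ⟨h.1, hlt⟩
      · exact hs hy
      · exact Set.disjoint_left.1 h2 hy ⟨hgt, h.2⟩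
    exact ((hC _ _ (by linarith) hdisj).differentiableOn one_ne_zero).differentiableAt
      (Icc_mem_nhds (by linarith) (by linarith))

theorem PiecewiseC1.isArcInDisk_comp {γ : ℝ → ℂ} (hγ : PiecewiseC1 γ) {S : ℂ → ℂ} {a b r : ℝ}
    (hab : a ≤ b) (hS : ∀ s ∈ Set.Icc a b, AnalyticAt ℂ S (γ s))
    (hr : ∀ s ∈ Set.Icc a b, ‖S (γ s)‖ < r) : IsArcInDisk (fun s => S (γ s)) a b r := by
  obtain ⟨E, hE, hd⟩ := hγ.exists_differentiableAt
  have hder : ∀ s ∈ Set.Icc a b, s ∉ E →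
      HasDerivAt (fun s => S (γ s)) (deriv S (γ s) * deriv γ s) s := fun s hs hsE =>
    (hS s hs).differentiableAt.hasDerivAt.comp_of_eq s (hd s hsE).hasDerivAt rfl
  refine ⟨hab, ?_, ?_, ⟨E, hE, fun s hs =>
    (hder s (Set.Ioo_subset_Icc_self hs.1) hs.2).differentiableAt⟩, hr⟩
  · exact fun s hs => ((hS s hs).continuousAt.comp_of_eq hγ.1.continuousAt rfl).continuousWithinAt
  · have hcont : ContinuousOn (fun s => deriv S (γ s)) (Set.Icc a b) := fun s hs =>
      ((hS s hs).deriv.continuousAt.comp_of_eq hγ.1.continuousAt rfl).continuousWithinAt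
    refine IntegrableOn.congr_fun_ae
      ((hγ.integrableOn_deriv a b).continuousOn_mul hcont isCompact_Icc) ?_
    refine (ae_restrict_iff' measurableSet_Icc).2 ?_
    filter_upwards [compl_mem_ae_iff.2 (hE.measure_zero volume)] with s hs hmem
    exact (hder s hmem hs).deriv.symm

/-! ### Convergence for larger `N` and the contribution away from the saddle point -/

theorem exists_pos_lower_bound_off_Icc {f : ℝ → ℝ} (hf : Continuous f) {s₀ σ₁ σ₂ : ℝ}
    (h₁ : σ₁ < s₀) (h₂ : s₀ < σ₂) (hpos : ∀ s, s ≠ s₀ → 0 < f s)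
    (hbot : ∃ η : ℝ, 0 < η ∧ ∀ᶠ s in atBot, η ≤ f s)
    (htop : ∃ η : ℝ, 0 < η ∧ ∀ᶠ s in atTop, η ≤ f s) :
    ∃ η > 0, ∀ s ∉ Set.Icc σ₁ σ₂, η ≤ f s := by
  obtain ⟨η₁, hη₁, he₁⟩ := hbot
  obtain ⟨η₂, hη₂, he₂⟩ := htop
  obtain ⟨A, hA⟩ := eventually_atBot.1 he₁
  obtain ⟨B, hB⟩ := eventually_atTop.1 he₂
  -- The `min` keeps the left interval nonempty, so a minimizer exists; the rest of the outside lies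
  -- in the two ends controlled by hypothesis.
  obtain ⟨x, hx, hxm⟩ := (isCompact_Icc.union isCompact_Icc).exists_isMinOn
    (s := Set.Icc (min A σ₁) σ₁ ∪ Set.Icc σ₂ (max B σ₂))
    ⟨σ₁, Or.inl ⟨min_le_right _ _, le_rfl⟩⟩ hf.continuousOn
  have hx0 : 0 < f x := by
    refine hpos x ?_
    rcases hx with hx | hx
    · exact (hx.2.trans_lt h₁).ne
    · exact (h₂.trans_le hx.1).ne'
  refine ⟨min (f x) (min η₁ η₂), by positivity, fun s hs => ?_⟩
  rcases lt_or_ge s σ₁ with h | h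
  · rcases le_or_gt s A with h' | h'
    · exact (min_le_right _ _).trans ((min_le_left _ _).trans (hA s h'))
    · exact (min_le_left _ _).trans
        (hxm (Or.inl ⟨(min_le_left _ _).trans h'.le, h.le⟩))
  · have h : σ₂ < s := by
      by_contra hle
      exact hs ⟨h, not_lt.1 hle⟩
    rcases le_or_gt B s with h' | h'
    · exact (min_le_right _ _).trans ((min_le_right _ _).trans (hB s h'))
    · exact (min_le_left _ _).trans
        (hxm (Or.inr ⟨h.le, h'.le.trans (le_max_left _ _)⟩))

theorem contourIntegrand_laplace_eq {n : ℕ} (γ : ℝ → ℂ) (p h : ℂ → ℂ) (q : (Fin n → ℂ) → ℂ)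
    (N N₀ : ℝ) (s : Fin n → ℝ) : contourIntegrand γ (laplaceIntegrand p h q N) s =
      Complex.exp (-((N - N₀ : ℝ) * ∑ j, p (γ (s j)))) *
        contourIntegrand γ (laplaceIntegrand p h q N₀) s := by
  simp only [contourIntegrand, laplaceIntegrand, ← mul_assoc, ← Complex.exp_add]
  congr 4
  push_cast
  ring

theorem norm_exp_sum_le {n : ℕ} {p : ℂ → ℂ} {x₀ : ℂ} {t : Fin n → ℂ} {M η : ℝ} (hM : 0 ≤ M)
    (h : η ≤ ∑ j, (p (t j) - p x₀).re) :
    ‖Complex.exp (-(M * ∑ j, p (t j)))‖ ≤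
      Real.exp (-(M * (n * (p x₀).re))) * Real.exp (-(M * η)) := by
  rw [Complex.norm_exp, ← Real.exp_add, Real.exp_le_exp, Complex.neg_re, Complex.re_ofReal_mul,
    Complex.re_sum]
  simp only [Complex.sub_re, Finset.sum_sub_distrib, Finset.sum_const, Finset.card_univ,
    Fintype.card_fin, nsmul_eq_mul] at h
  nlinarith

/-- Passing from `N₀` to `N` multiplies the integrand by a bounded continuous function, since `Re p
≥ Re p(x₀)` on the path. -/
theorem contourIntegrable_laplace_of_le {n : ℕ} {γ : ℝ → ℂ} {p h : ℂ → ℂ}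
    {q : (Fin n → ℂ) → ℂ} {x₀ : ℂ} (hp : Continuous fun s => p (γ s))
    (hnonneg : ∀ s, 0 ≤ (p (γ s) - p x₀).re) {N₀ N : ℝ}
    (hconv : ContourIntegrable γ (laplaceIntegrand p h q N₀)) (hN : N₀ ≤ N) :
    ContourIntegrable γ (laplaceIntegrand p h q N) := by
  have : contourIntegrand γ (laplaceIntegrand p h q N) = fun s =>
      Complex.exp (-((N - N₀ : ℝ) * ∑ j, p (γ (s j)))) *
        contourIntegrand γ (laplaceIntegrand p h q N₀) s :=
    funext fun s => contourIntegrand_laplace_eq γ p h q N N₀ s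
  rw [ContourIntegrable, this]
  refine hconv.bdd_mul (c := Real.exp (-((N - N₀) * (n * (p x₀).re))) *
    Real.exp (-((N - N₀) * 0))) ?_ (ae_of_all _ fun s => ?_)
  · have : Continuous fun s : Fin n → ℝ => Complex.exp (-((N - N₀ : ℝ) * ∑ j, p (γ (s j)))) := by
      have h1 : ∀ j : Fin n, Continuous fun s : Fin n → ℝ => p (γ (s j)) := fun j =>
        hp.comp (continuous_apply j)
      exact (continuous_const.mul (continuous_finsetSum _ fun j _ => h1 j)).neg.cexp
    exact this.aestronglyMeasurable
  · exact norm_exp_sum_le (sub_nonneg.2 hN) (Finset.sum_nonneg fun j _ => hnonneg _)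

/-- Outside the box some coordinate contributes at least `η` and the others are nonnegative. This
gains `exp(-(N - N₀)η)`, which beats any power of `N`. -/
theorem isBigO_integral_compl_paramBox {n : ℕ} {γ : ℝ → ℂ} {p h : ℂ → ℂ}
    {q : (Fin n → ℂ) → ℂ} {x₀ : ℂ} (hnonneg : ∀ s, 0 ≤ (p (γ s) - p x₀).re) {N₀ : ℝ}
    (hconv : ContourIntegrable γ (laplaceIntegrand p h q N₀)) {σ₁ σ₂ η : ℝ} (hη : 0 < η)
    (hoff : ∀ s ∉ Set.Icc σ₁ σ₂, η ≤ (p (γ s) - p x₀).re) (e : ℝ) :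
    (fun N : ℝ => ∫ s in (paramBox n σ₁ σ₂)ᶜ, contourIntegrand γ (laplaceIntegrand p h q N) s)
      =O[atTop] fun N : ℝ => Complex.exp (-(n * N * p x₀)) * ((N ^ e : ℝ) : ℂ) := by
  set A := ∫ s in (paramBox n σ₁ σ₂)ᶜ, ‖contourIntegrand γ (laplaceIntegrand p h q N₀) s‖
  have hA : 0 ≤ A := integral_nonneg fun _ => norm_nonneg _
  have h1 : (fun N : ℝ => ∫ s in (paramBox n σ₁ σ₂)ᶜ,
      contourIntegrand γ (laplaceIntegrand p h q N) s) =O[atTop] fun N : ℝ =>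
      Real.exp (-(N * (n * (p x₀).re))) * Real.exp (-η * N) := by
    refine IsBigO.of_bound (A * (Real.exp (N₀ * (n * (p x₀).re)) * Real.exp (N₀ * η))) ?_
    filter_upwards [eventually_ge_atTop N₀] with N hN
    have hle : ‖∫ s in (paramBox n σ₁ σ₂)ᶜ, contourIntegrand γ (laplaceIntegrand p h q N) s‖ ≤
        Real.exp (-((N - N₀) * (n * (p x₀).re))) * Real.exp (-((N - N₀) * η)) * A := by
      rw [← integral_const_mul]
      refine norm_integral_le_of_norm_le (hconv.integrableOn.norm.const_mul _) ?_
      refine (ae_restrict_iff' (measurableSet_paramBox n _ _).compl).2 (ae_of_all _ fun s hs => ?_)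
      rw [contourIntegrand_laplace_eq γ p h q N N₀, norm_mul]
      gcongr
      refine norm_exp_sum_le (sub_nonneg.2 hN) ?_
      obtain ⟨j, hj⟩ : ∃ j, s j ∉ Set.Icc σ₁ σ₂ := by
        by_contra! hall
        exact hs fun j _ => hall j
      exact (hoff _ hj).trans (Finset.single_le_sum (f := fun j => (p (γ (s j)) - p x₀).re)
        (fun i _ => hnonneg _) (Finset.mem_univ j))
    refine hle.trans (le_of_eq ?_)
    rw [Real.norm_of_nonneg (by positivity), mul_comm, mul_assoc A]
    congr 1
    simp only [← Real.exp_add]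
    congr 1
    ring
  have h2 : (fun N : ℝ => Real.exp (-(N * (n * (p x₀).re))) * Real.exp (-η * N)) =O[atTop]
      fun N : ℝ => Real.exp (-(N * (n * (p x₀).re))) * N ^ e :=
    (isBigO_refl _ _).mul (isLittleO_exp_neg_mul_rpow_atTop hη e).isBigO
  refine (h1.trans h2).trans (IsBigO.of_norm_right (IsBigO.of_bound 1 ?_))
  filter_upwards with N
  rw [norm_mul, norm_norm, norm_mul, Complex.norm_exp, Complex.norm_real, one_mul,
    Real.norm_of_nonneg (Real.exp_pos _).le]
  refine le_of_eq ?_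
  congr 2
  rw [Complex.neg_re, mul_assoc, mul_comm (n : ℂ), mul_assoc, Complex.re_ofReal_mul, mul_comm (p x₀),
    ← Complex.ofReal_natCast, Complex.re_ofReal_mul]

/-! ### The integrand in local coordinates -/

theorem vanderProd_comp {n : ℕ} (φ : ℂ → ℂ) (w : Fin n → ℂ) :
    vanderProd (fun j => φ (w j)) =
      (∏ i, ∏ j ∈ Finset.Ioi i, dslope φ (w i) (w j)) * vanderProd w := by
  simp only [vanderProd, ← Finset.prod_mul_distrib]
  refine Finset.prod_congr rfl fun i _ => Finset.prod_congr rfl fun j _ => ?_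
  rw [← neg_sub, sub_eq_mul_dslope]
  ring

/-- The Laplace integrand in the local coordinates `w`, without the factor `exp(-n N p(x₀))`. -/
noncomputable def localIntegrand {n : ℕ} (p₀ : ℂ) (μ : ℕ) (h : ℂ → ℂ) (f : (Fin n → ℂ) → ℂ)
    (w : Fin n → ℂ) : ℂ :=
  Complex.exp (-(p₀ * ∑ j, w j ^ μ)) * h (vanderProd w) * f w

theorem polyApprox_localIntegrand {n : ℕ} (p₀ : ℂ) (μ : ℕ) {h : ℂ → ℂ} (hh : Differentiable ℂ h)
    {f : (Fin n → ℂ) → ℂ} {r : ℝ} (hf : PolyApprox (Metric.ball 0 r) f) :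
    PolyApprox (Metric.ball 0 r) (localIntegrand p₀ μ h f) := by
  have h1 := PolyApprox.entire_comp Complex.differentiable_exp
    (-(MvPolynomial.C p₀ * ∑ j : Fin n, MvPolynomial.X j ^ μ)) r
  have h2 := PolyApprox.entire_comp hh
    (∏ i : Fin n, ∏ j ∈ Finset.Ioi i, (MvPolynomial.X i - MvPolynomial.X j)) r
  have h3 := (h1.mul h2).mul hf
  simp only [map_neg, map_mul, map_sum, map_pow, map_prod, map_sub, MvPolynomial.eval_C,
    MvPolynomial.eval_X] at h3
  exact h3

/-- The positive real part is exactly what homogeneity of `h` requires to extract the product of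
difference quotients. -/
theorem laplaceIntegrand_comp {n : ℕ} {p h φ : ℂ → ℂ} {x₀ p₀ : ℂ} {μ : ℕ} {ν : ℝ}
    (hhom : ∀ c : ℂ, 0 < c.re → ∀ x : ℂ, h (c * x) = c ^ (ν : ℂ) * h x)
    (q : (Fin n → ℂ) → ℂ) (N : ℝ) {w : Fin n → ℂ}
    (hp : ∀ j, p (φ (w j)) = p x₀ + p₀ * w j ^ μ)
    (hre : 0 < (∏ i, ∏ j ∈ Finset.Ioi i, dslope φ (w i) (w j)).re) :
    laplaceIntegrand p h q N (fun j => φ (w j)) * ∏ j, deriv φ (w j) =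
      Complex.exp (-(n * N * p x₀)) * localIntegrand (N * p₀) μ h (amplitude q ν φ) w := by
  have he : Complex.exp (-(N * ∑ j, p (φ (w j)))) =
      Complex.exp (-(n * N * p x₀)) * Complex.exp (-(N * p₀ * ∑ j, w j ^ μ)) := by
    rw [← Complex.exp_add]
    congr 1
    simp only [hp, Finset.sum_add_distrib, Finset.sum_const, Finset.card_univ, Fintype.card_fin,
      nsmul_eq_mul, ← Finset.mul_sum]
    ring
  rw [laplaceIntegrand, localIntegrand, amplitude, vanderProd_comp, hhom _ hre, he]
  ring

theorem deriv_eq_mul_of_eventually_eq_comp {γ : ℝ → ℂ} {S φ : ℂ → ℂ} {s : ℝ}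
    (hγ : DifferentiableAt ℝ γ s) (hS : DifferentiableAt ℂ S (γ s))
    (hφ : DifferentiableAt ℂ φ (S (γ s))) (he : ∀ᶠ s' in 𝓝 s, φ (S (γ s')) = γ s') :
    deriv γ s = deriv φ (S (γ s)) * deriv (fun s => S (γ s)) s := by
  have h1 : HasDerivAt (fun s => S (γ s)) (deriv S (γ s) * deriv γ s) s :=
    hS.hasDerivAt.comp_of_eq s hγ.hasDerivAt rfl
  have h2 : HasDerivAt (fun s => φ (S (γ s)))
      (deriv φ (S (γ s)) * deriv (fun s => S (γ s)) s) s := by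
    rw [h1.deriv]
    exact hφ.hasDerivAt.comp_of_eq s h1 rfl
  exact (h2.congr_of_eventuallyEq (he.mono fun _ h => h.symm)).deriv

theorem deriv_eq_one_of_local_inverse {S φ : ℂ → ℂ} {x₀ : ℂ} (hφ0 : φ 0 = x₀)
    (hφ : AnalyticAt ℂ φ 0) (hS : AnalyticAt ℂ S x₀) (hS' : deriv S x₀ = 1)
    (h : ∀ᶠ v in 𝓝 (0 : ℂ), S (φ v) = v) : deriv φ 0 = 1 := by
  have h1 : HasDerivAt (fun v => S (φ v)) (deriv S x₀ * deriv φ 0) 0 :=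
    hS.differentiableAt.hasDerivAt.comp_of_eq (0 : ℂ) hφ.differentiableAt.hasDerivAt hφ0.symm
  have hid : id =ᶠ[𝓝 0] fun v => S (φ v) := h.mono fun _ h => h.symm
  have h2 := (h1.congr_of_eventuallyEq hid).unique (hasDerivAt_id (0 : ℂ))
  rwa [hS', one_mul] at h2

/-! ### The asymptotic expansion -/

theorem theorem3p4 {n : ℕ} (T : Set ℂ) (hTo : IsOpen T) (hTc : IsConnected T)
    (p : ℂ → ℂ) (hp : DifferentiableOn ℂ p T)
    (q : (Fin n → ℂ) → ℂ) (hq : AnalyticOnNhd ℂ q (Set.univ.pi fun _ => T))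
    (ν : ℝ) (hν : 0 ≤ ν) (h : ℂ → ℂ) (hh : Differentiable ℂ h)
    (hhom : ∀ c : ℂ, 0 < c.re → ∀ x : ℂ, h (c * x) = c ^ (ν : ℂ) * h x)
    -- the integration path and the saddle point `x₀ = γ s₀` on it
    (a b : OnePoint ℂ) (γ : ℝ → ℂ) (hγ : IsContour γ T a b)
    (s₀ : ℝ) (x₀ : ℂ) (hx₀ : γ s₀ = x₀) (μ : ℕ) (hμ : 2 ≤ μ)
    (hsaddle : ∀ k : ℕ, 1 ≤ k → k < μ → iteratedDeriv k p x₀ = 0)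
    (hsaddle' : iteratedDeriv μ p x₀ ≠ 0)
    -- `q(t) = (t - t₀)^(lam-1) g(t - t₀)` near `t₀ = (x₀, …, x₀)`, with a convergent series `g`
    (lam : Fin n → ℝ) (hlam : ∀ j, 0 < lam j)
    (g : (Fin n → ℂ) → ℂ) (hg : AnalyticAt ℂ g 0)
    (hqg : ∀ᶠ t in 𝓝 (fun _ : Fin n => x₀), (∀ j, t j ≠ x₀) →
      q t = powSubOne lam (fun j => t j - x₀) * g (fun j => t j - x₀))
    -- absolute convergence for one value of the parameter
    (N₀ : ℝ) (hN₀ : 0 < N₀) (hconv : ContourIntegrable γ (laplaceIntegrand p h q N₀))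
    -- `Re (p - p x₀)` is positive on the path off `x₀`, and bounded away from `0` at its two ends
    (hpos : ∀ s : ℝ, s ≠ s₀ → 0 < (p (γ s) - p x₀).re)
    (hbot : ∃ η : ℝ, 0 < η ∧ ∀ᶠ s in atBot, η ≤ (p (γ s) - p x₀).re)
    (htop : ∃ η : ℝ, 0 < η ∧ ∀ᶠ s in atTop, η ≤ (p (γ s) - p x₀).re) :
    (∀ N : ℝ, N₀ ≤ N → ContourIntegrable γ (laplaceIntegrand p h q N)) ∧
    -- the inverse `φ` of the local coordinate
    ∃ φ : ℂ → ℂ, AnalyticAt ℂ φ 0 ∧ φ 0 = x₀ ∧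
      (∀ᶠ v in 𝓝 (0 : ℂ), saddleCoord p x₀ μ (φ v) = v) ∧
      (∀ᶠ x in 𝓝 x₀, φ (saddleCoord p x₀ μ x) = x) ∧
      -- the convergent expansion `f(w) = w^(lam-1) ∑_k α_k(w)`, with `α k` homogeneous of degree `k`
      ∃ α : ℕ → MvPolynomial (Fin n) ℂ, (∀ k, (α k).IsHomogeneous k) ∧
        (∀ᶠ w in 𝓝 (0 : Fin n → ℂ), (∀ j, w j ≠ 0) →
          HasSum (fun k => powSubOne lam w * MvPolynomial.eval w (α k)) (amplitude q ν φ w)) ∧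
        -- all `τ₁ = γ σ₁` and `τ₂ = γ σ₂` on the path before and after `x₀` and close to it
        ∃ δ : ℝ, 0 < δ ∧ ∀ σ₁ ∈ Set.Ioo (s₀ - δ) s₀, ∀ σ₂ ∈ Set.Ioo s₀ (s₀ + δ),
          let L : ℝ → ℂ := rayPath (saddleCoord p x₀ μ (γ σ₁)) (saddleCoord p x₀ μ (γ σ₂))
          (∀ k, ContourIntegrable L (coeffIntegrand (leadCoeff p x₀ μ) μ h lam (α k))) ∧
          ∀ m : ℕ,
            (fun N : ℝ => contourIntegral γ (laplaceIntegrand p h q N) -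
              Complex.exp (-(n * N * p x₀)) * ∑ k ∈ Finset.range m,
                contourIntegral L (coeffIntegrand (leadCoeff p x₀ μ) μ h lam (α k)) *
                  ((N ^ (-expansionExponent ν lam μ k) : ℝ) : ℂ))
            =O[atTop] fun N : ℝ => Complex.exp (-(n * N * p x₀)) *
              ((N ^ (-expansionExponent ν lam μ m) : ℝ) : ℂ) := by
  have hμ1 : 1 ≤ μ := by omega
  have hx₀T : x₀ ∈ T := hx₀ ▸ hγ.mem s₀
  have hpγ : Continuous fun s => p (γ s) :=
    hp.continuousOn.comp_continuous hγ.piecewise.1 hγ.mem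
  have hnonneg : ∀ s, 0 ≤ (p (γ s) - p x₀).re := fun s => by
    rcases eq_or_ne s s₀ with rfl | hs
    · simp [hx₀]
    · exact (hpos s hs).le
  have hint : ∀ N : ℝ, N₀ ≤ N → ContourIntegrable γ (laplaceIntegrand p h q N) := fun N hN =>
    contourIntegrable_laplace_of_le hpγ hnonneg hconv hN
  have hpa : AnalyticAt ℂ p x₀ := hp.analyticAt (hTo.mem_nhds hx₀T)
  have hp₀ : leadCoeff p x₀ μ ≠ 0 :=
    div_ne_zero hsaddle' (by exact_mod_cast μ.factorial_ne_zero)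
  obtain ⟨hSa, hS'⟩ := saddleCoord_analyticAt hμ1 hpa hsaddle hp₀
  have hSpow := leadCoeff_mul_saddleCoord_pow (p := p) (x₀ := x₀) hμ1 hp₀
  have hS0 : saddleCoord p x₀ μ x₀ = 0 := by simp [saddleCoord]
  obtain ⟨φ, hφ, hφ0, hSφ, hφS⟩ := exists_analytic_local_inverse hSa (by rw [hS']; exact one_ne_zero)
  rw [hS0] at hφ hφ0 hSφ
  have hφ' : deriv φ 0 = 1 := deriv_eq_one_of_local_inverse hφ0 hφ hSa hS' hSφ
  have hqa : AnalyticAt ℂ q (fun _ => φ 0) := by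
    rw [hφ0]
    exact hq _ fun _ _ => hx₀T
  obtain ⟨F, hF, hampF⟩ := amplitude_factor hφ hφ' ν hqa hg hlam (by rwa [hφ0])
  obtain ⟨PA, RA, hPA⟩ := amplitude_analyticAt hφ hφ' ν hqa
  obtain ⟨P, R, hP⟩ := hF
  refine ⟨hint, φ, hφ, hφ0, hSφ, hφS, seriesTerm P, seriesTerm_isHomogeneous P, ?_, ?_⟩
  · filter_upwards [hampF, Metric.eball_mem_nhds (0 : Fin n → ℂ) hP.r_pos] with w hw hwR hw0
    rw [hw hw0]
    refine HasSum.mul_left _ ?_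
    have := hP.hasSum hwR
    rw [zero_add] at this
    simpa only [eval_seriesTerm] using this
  have hre : ∀ᶠ w in 𝓝 (0 : Fin n → ℂ),
      0 < (∏ i, ∏ j ∈ Finset.Ioi i, dslope φ (w i) (w j)).re := by
    have hc := Complex.continuous_re.continuousAt.comp
      (prod_dslope_analyticAt (n := n) hφ).continuousAt
    refine hc.eventually_const_lt ?_
    rw [Function.comp_apply, prod_dslope_zero hφ', Complex.one_re]
    exact one_pos
  obtain ⟨ρ, hρ, hball⟩ := Metric.eventually_nhds_iff_ball.1 (hampF.and hre)
  obtain ⟨ρ', hρ', hball'⟩ := Metric.eventually_nhds_iff_ball.1 hφ.eventually_analyticAt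
  -- On the polydisk of radius `r` both power series converge, the factorization and the positivity
  -- of the real part hold, and `φ` is analytic.
  obtain ⟨r, hr0, hr⟩ := ENNReal.lt_iff_exists_nnreal_btwn.1
    (lt_min (lt_min hPA.r_pos hP.r_pos)
      (lt_min (ENNReal.ofReal_pos.2 hρ) (ENNReal.ofReal_pos.2 hρ')))
  rw [lt_min_iff, lt_min_iff, lt_min_iff] at hr
  obtain ⟨⟨hrA, hrP⟩, hrρ, hrρ'⟩ := hr
  have hr0 : 0 < r := by exact_mod_cast hr0
  have hr0' : (0 : ℝ) < r := hr0
  have hrρ : (r : ℝ) < ρ := by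
    rwa [ENNReal.ofReal, ENNReal.coe_lt_coe, Real.lt_toNNReal_iff_coe_lt] at hrρ
  have hrρ' : (r : ℝ) < ρ' := by
    rwa [ENNReal.ofReal, ENNReal.coe_lt_coe, Real.lt_toNNReal_iff_coe_lt] at hrρ'
  have hSr : ∀ᶠ x in 𝓝 x₀, ‖saddleCoord p x₀ μ x‖ < r := by
    refine hSa.continuousAt.norm.eventually_lt_const ?_
    simpa [hS0] using hr0'
  have hnear : ∀ᶠ s in 𝓝 s₀, AnalyticAt ℂ (saddleCoord p x₀ μ) (γ s) ∧
      φ (saddleCoord p x₀ μ (γ s)) = γ s ∧ ‖saddleCoord p x₀ μ (γ s)‖ < r := by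
    have ht : Tendsto γ (𝓝 s₀) (𝓝 x₀) := hx₀ ▸ hγ.piecewise.1.tendsto s₀
    exact ht.eventually (hSa.eventually_analyticAt.and (hφS.and hSr))
  obtain ⟨δ, hδ, hδb⟩ := Metric.eventually_nhds_iff_ball.1 hnear
  rw [Real.ball_eq_Ioo] at hδb
  refine ⟨δ, hδ, fun σ₁ hσ₁ σ₂ hσ₂ => ?_⟩
  intro L
  have hsub : Set.Icc σ₁ σ₂ ⊆ Set.Ioo (s₀ - δ) (s₀ + δ) := fun s hs =>
    ⟨hσ₁.1.trans_le hs.1, hs.2.trans_lt hσ₂.2⟩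
  have hσ : σ₁ ≤ σ₂ := (hσ₁.2.trans hσ₂.1).le
  have hκ₁ := (hδb σ₁ (hsub ⟨le_rfl, hσ⟩)).2.2
  have hκ₂ := (hδb σ₂ (hsub ⟨hσ, le_rfl⟩)).2.2
  -- Positivity of `Re (p - p(x₀))` at `τ₁` is the decay condition along the whole ray through
  -- `w(τ₁)`.
  have h₁ : 0 < (leadCoeff p x₀ μ * saddleCoord p x₀ μ (γ σ₁) ^ μ).re := by
    rw [hSpow]; exact hpos _ hσ₁.2.ne
  have h₂ : 0 < (leadCoeff p x₀ μ * saddleCoord p x₀ μ (γ σ₂) ^ μ).re := by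
    rw [hSpow]; exact hpos _ hσ₂.1.ne'
  have hne : ∀ κ : ℂ, 0 < (leadCoeff p x₀ μ * κ ^ μ).re → κ ≠ 0 := by
    rintro κ hκ rfl
    simp [zero_pow (show μ ≠ 0 by omega)] at hκ
  refine ⟨fun k => (integrable_rayKernel_mul_eval hμ1 h₁ h₂ hh.continuous hhom hlam
    (seriesTerm_isHomogeneous P k)).congr (coeffIntegrand_rayPath_ae _ _ _ _ _ _ _).symm,
    fun m => ?_⟩
  obtain ⟨η, hη, hoff⟩ := exists_pos_lower_bound_off_Icc
    (Complex.continuous_re.comp (hpγ.sub continuous_const)) hσ₁.2 hσ₂.1 hpos hbot htop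
  have htail := isBigO_integral_compl_paramBox hnonneg hconv hη hoff
    (-expansionExponent ν lam μ m)
  have hmain := isBigO_ray_expansion hP hr0 hrP hκ₁ hκ₂ hμ1 h₁ h₂ hh.continuous hhom hlam m
  have harc : IsArcInDisk (fun s => saddleCoord p x₀ μ (γ s)) σ₁ σ₂ r :=
    hγ.piecewise.isArcInDisk_comp hσ (fun s hs => (hδb s (hsub hs)).1)
      fun s hs => (hδb s (hsub hs)).2.2
  have hray : IsArcInDisk L (-1) 1 r := isArcInDisk_rayPath hκ₁ hκ₂
  -- the part of the integral near the saddle point, in local coordinates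
  have hlocal : ∀ N : ℝ,
      ∫ s in paramBox n σ₁ σ₂, contourIntegrand γ (laplaceIntegrand p h q N) s =
        Complex.exp (-(n * N * p x₀)) * ∫ s in paramBox n (-1) 1,
          rayKernel (saddleCoord p x₀ μ (γ σ₁)) (saddleCoord p x₀ μ (γ σ₂))
            (N * leadCoeff p x₀ μ) μ h lam s *
              F fun j => rayPath (saddleCoord p x₀ μ (γ σ₁)) (saddleCoord p x₀ μ (γ σ₂)) (s j) := by
    intro N
    have hpoly : PolyApprox (Metric.ball 0 (r : ℝ))
        (localIntegrand (N * leadCoeff p x₀ μ) μ h (amplitude q ν φ)) :=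
      polyApprox_localIntegrand _ μ hh (PolyApprox.of_hasFPowerSeriesOnBall hPA hrA)
    have e1 : ∫ s in paramBox n σ₁ σ₂, contourIntegrand γ (laplaceIntegrand p h q N) s =
        Complex.exp (-(n * N * p x₀)) * ∫ s in paramBox n σ₁ σ₂,
          contourIntegrand (fun s => saddleCoord p x₀ μ (γ s))
            (localIntegrand (N * leadCoeff p x₀ μ) μ h (amplitude q ν φ)) s := by
      rw [← integral_const_mul]
      refine integral_congr_ae ((ae_restrict_iff' (measurableSet_paramBox n _ _)).2 ?_)
      obtain ⟨E, hE, hd⟩ := hγ.piecewise.exists_differentiableAt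
      have hae : ∀ᵐ s : Fin n → ℝ, ∀ j, s j ∉ E := ae_all_iff.2 fun j =>
        (Measure.tendsto_eval_ae_ae (μ := fun _ : Fin n => (volume : Measure ℝ)) (i := j)).eventually
          (compl_mem_ae_iff.2 (hE.measure_zero volume))
      filter_upwards [hae] with s hsE hs
      have hsj : ∀ j, s j ∈ Set.Icc σ₁ σ₂ := fun j => hs j (Set.mem_univ j)
      have hw := harc.norm_comp_lt hr0' hs
      have hderiv : ∀ j, deriv γ (s j) = deriv φ (saddleCoord p x₀ μ (γ (s j))) *
          deriv (fun s => saddleCoord p x₀ μ (γ s)) (s j) := fun j => by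
        have hj := hδb _ (hsub (hsj j))
        refine deriv_eq_mul_of_eventually_eq_comp (hd _ (hsE j)) hj.1.differentiableAt
          (hball' _ ?_).differentiableAt ?_
        · rw [mem_ball_zero_iff]
          exact hj.2.2.trans hrρ'
        · filter_upwards [Ioo_mem_nhds (hsub (hsj j)).1 (hsub (hsj j)).2] with s' hs'
          exact (hδb _ hs').2.1
      have hφj : ∀ j, φ (saddleCoord p x₀ μ (γ (s j))) = γ (s j) := fun j =>
        (hδb _ (hsub (hsj j))).2.1
      have key := laplaceIntegrand_comp (p₀ := leadCoeff p x₀ μ) (μ := μ) hhom q N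
        (w := fun j => saddleCoord p x₀ μ (γ (s j))) (p := p) (φ := φ) (x₀ := x₀)
        (fun j => by rw [hφj, hSpow]; ring) (hball _ (Metric.ball_subset_ball hrρ.le hw)).2
      simp only [hφj] at key
      rw [contourIntegrand, contourIntegrand, Finset.prod_congr rfl fun j _ => hderiv j,
        Finset.prod_mul_distrib, ← mul_assoc, key, mul_assoc]
    -- Cauchy's theorem: the image arc and the pair of segments share the endpoints `w(τ₁)` and
    -- `w(τ₂)`.
    rw [e1, harc.integral_contourIntegrand_eq hray hr0' (by simp [L, rayPath])
      (by simp [L, rayPath]) hpoly]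
    congr 1
    refine integral_congr_ae ((ae_restrict_iff' (measurableSet_paramBox n _ _)).2 ?_)
    -- The factorization of the amplitude is known only where no `w_j` vanishes, that is, for almost
    -- every parameter.
    filter_upwards [contourIntegrand_rayPath_ae (saddleCoord p x₀ μ (γ σ₁))
      (saddleCoord p x₀ μ (γ σ₂))
      (localIntegrand (N * leadCoeff p x₀ μ) μ h (amplitude q ν φ)), ae_forall_ne_zero n]
      with s hs hs0 hsbox
    have hw := Metric.ball_subset_ball hrρ.le (hray.norm_comp_lt hr0' hsbox)
    rw [hs, localIntegrand, rayKernel, (hball _ hw).1 fun j =>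
      rayPath_ne_zero (hne _ h₁) (hne _ h₂) (hs0 j)]
    ring
  have hcoeff : ∀ k, contourIntegral L (coeffIntegrand (leadCoeff p x₀ μ) μ h lam (seriesTerm P k)) =
      ∫ s, rayKernel (saddleCoord p x₀ μ (γ σ₁)) (saddleCoord p x₀ μ (γ σ₂)) (leadCoeff p x₀ μ)
        μ h lam s * MvPolynomial.eval (fun j => rayPath (saddleCoord p x₀ μ (γ σ₁))
          (saddleCoord p x₀ μ (γ σ₂)) (s j)) (seriesTerm P k) := fun k =>
    integral_congr_ae (coeffIntegrand_rayPath_ae _ _ _ _ _ _ _)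
  have hmain' := (isBigO_refl (fun N : ℝ => Complex.exp (-(n * N * p x₀))) atTop).mul
    (hmain.trans (IsBigO.of_norm_right (g' := fun N : ℝ =>
      ((N ^ (-expansionExponent ν lam μ m) : ℝ) : ℂ)) (by
        simpa only [Complex.norm_real] using (isBigO_refl _ _).norm_right)))
  refine (htail.add hmain').congr' ?_ EventuallyEq.rfl
  -- For `N ≥ N₀` the full integral converges absolutely and splits into the box and its complement.
  filter_upwards [eventually_ge_atTop N₀] with N hN
  have hI : contourIntegral γ (laplaceIntegrand p h q N) = _ :=
    (integral_add_compl (measurableSet_paramBox n σ₁ σ₂) (hint N hN)).symm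
  rw [hI, hlocal]
  simp only [hcoeff]
  ring
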